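/- All matrices are complex, $M^\dagger$ is the conjugate transpose, and $M>0$ means Hermitian positive definite. $H_\infty$ is the set of proper rational matrix functions with no poles in $\operatorname{Re}s\ge 0$, and $\|M\|_\infty=\sup_{\operatorname{Re}s>0}\bar\sigma(M(s))$, with $\bar\sigma$ the largest singular value ($\|M\|_\infty=\infty$ for rational $M\notin H_\infty$). A matrix is Hurwitz if all its eigenvalues have negative real part. For a plant $\mathscr P=\begin{bmatrix}\mathscr P_{11}&\mathscr P_{12}\\ \mathscr P_{21}&\mathscr P_{22}\end{bmatrix}\sim\left[\begin{array}{c|cc}A&B_1&B_2\\ \hline C_1&D_{11}&D_{12}\\ C_2&D_{21}&D_{22}\end{array}\right]$, i.e. $\mathscr P_{jk}(s)=C_j(sI-A)^{-1}B_k+D_{jk}$, and a controller $\mathscr C$, let $\mathscr F_l(\mathscr P,\mathscr C)=\mathscr P_{11}+\mathscr P_{12}\mathscr C(I-\mathscr P_{22}\mathscr C)^{-1}\mathscr P_{21}$; $\mathscr C$ is internally stabilizing if the feedback interconnection of the plant's realization with a state-space realization of $\mathscr C$ is well posed and has a Hurwitz state matrix. Let $\gamma>0$, $\lambda\ge 0$,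 $\bar\gamma=(\gamma^2+\lambda^2)^{1/2}$, and let $A_\lambda\in\mathbf C^{m\times m}$ (Hurwitz), $B_\lambda\in\mathbf C^{m\times p}$, $C_{1,\lambda}\in\mathbf C^{n_y\times m}$, $C_{2,\lambda}\in\mathbf C^{n\times m}$, $D_{1,\lambda}\in\mathbf C^{n_y\times p}$, $D_{2,\lambda}\in\mathbf C^{n\times p}$. Assume (i) $\bar E_1:=D_{1,\lambda}D_{1,\lambda}^\dagger>0$; (ii) $D_{2,\lambda}\Pi D_{2,\lambda}^\dagger<(\gamma^2+\lambda^2)I_n$, where $\Pi:=I_p-D_{1,\lambda}^\dagger\bar E_1^{-1}D_{1,\lambda}$. Let $D_{1,\lambda}=\bar V_{12}\,[\,0\ \ \bar\Sigma_{12}\,]\,\bar W_{12}^\dagger$ be any singular value decomposition ($\bar V_{12},\bar W_{12}$ unitary, $\bar\Sigma_{12}>0$ diagonal $n_y\times n_y$); put $S=\bar\gamma^{-1}\bar W_{12}^\dagger\Pi D_{2,\lambda}^\dagger$, $R_1=I_n-S^\dagger S$, $R_2=I_p-SS^\dagger$ (both positive definite), let $R_1^{-1/2},R_2^{-1/2}$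 be the positive definite square roots of the inverses, and let $R_1^{-1/2}=\bar W_{21}\bar\Sigma_{21}\bar W_{21}^\dagger$ with $\bar W_{21}$ unitary and $\bar\Sigma_{21}>0$ diagonal. With $G:=C_{2,\lambda}^\dagger-C_{1,\lambda}^\dagger\bar E_1^{-1}D_{1,\lambda}D_{2,\lambda}^\dagger$ define $$\tilde A=A_\lambda^\dagger+\bar\gamma^{-2}GR_1^{-1}D_{2,\lambda}\Pi B_\lambda^\dagger,\quad \tilde B_1=\bar\gamma^{-1}G\bar W_{21}\bar\Sigma_{21},\quad \tilde B_2=C_{1,\lambda}^\dagger\bar V_{12}\bar\Sigma_{12}^{-1},$$ $$\tilde C_1=R_2^{-1/2}\bar W_{12}^\dagger B_\lambda^\dagger,\quad \tilde C_2=\bar\gamma^{-1}\bar W_{21}^\dagger R_1^{-1/2}D_{2,\lambda}\Pi B_\lambda^\dagger,$$ $$\mathscr P\sim\left[\begin{array}{c|cc}A_\lambda^\dagger&C_{2,\lambda}^\dagger&C_{1,\lambda}^\dagger\\ \hline B_\lambda^\dagger&D_{2,\lambda}^\dagger&D_{1,\lambda}^\dagger\\ 0&I_n&0\end{array}\right],\qquad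 \tilde{\mathscr P}\sim\left[\begin{array}{c|cc}\tilde A&\tilde B_1&\tilde B_2\\ \hline \tilde C_1&0&\begin{bmatrix}0\\ I_{n_y}\end{bmatrix}\\ \tilde C_2&I_n&0\end{array}\right],$$ $$V=\bar\gamma\bar V_{12}\bar\Sigma_{12}^{-1},\qquad W=\bar W_{21}\bar\Sigma_{21}^{-1},\qquad J=\bar E_1^{-1}D_{1,\lambda}D_{2,\lambda}^\dagger.$$ Then $V$ and $W$ are nonsingular, and there exists an internally stabilizing controller $\bar H_{11}\in H_\infty$ for $\mathscr P$ with $$\|\mathscr F_l(\mathscr P,\bar H_{11})\|_\infty<\bar\gamma\quad\text{and}\quad\|\bar H_{11}\|_\infty<1 \tag{a}$$ if and only if there exists an internally stabilizing controller $\mathscr C\in H_\infty$ for $\tilde{\mathscr P}$ with $$\|\mathscr F_l(\tilde{\mathscr P},\mathscr C)\|_\infty<1\quad\text{and}\quad\|V\mathscr CW^\dagger-J\|_\infty<1. \tag{b}$$ Moreover, the map $$\mathscr C\ \mapsto\ \bar H_{11}=\bar\gamma\bar V_{12}\bar\Sigma_{12}^{-1}\,\mathscr C\,\bar\Sigma_{21}^{-1}\bar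 W_{21}^\dagger-\bar E_1^{-1}D_{1,\lambda}D_{2,\lambda}^\dagger$$ is a bijection from the set of solutions $\mathscr C$ of (b) onto the set of solutions $\bar H_{11}$ of (a). -/

import Mathlib

open Matrix
open scoped ENNReal ComplexOrder

noncomputable section

namespace TwoDisk

/-! ### Rational transfer matrices and their H-infinity norm -/

/-- Rational `a × b` matrix transfer functions in the Laplace variable `s = RatFunc.X`. -/
abbrev TFMat (a b : ℕ) : Type := Matrix (Fin a) (Fin b) (RatFunc ℂ)

/-- A complex matrix regarded as a constant transfer function. -/
def const {a b : ℕ} (M : Matrix (Fin a) (Fin b) ℂ) : TFMat a b :=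
  M.map fun c => RatFunc.C c

/-- The transfer function `C (sI - A)⁻¹ B + D`; the inverse is the genuine one, since
`det (sI - A)` is a nonzero polynomial. -/
def transfer {k a b : ℕ} (A : Matrix (Fin k) (Fin k) ℂ) (B : Matrix (Fin k) (Fin b) ℂ)
    (C : Matrix (Fin a) (Fin k) ℂ) (D : Matrix (Fin a) (Fin b) ℂ) : TFMat a b :=
  const C * ((RatFunc.X : RatFunc ℂ) • (1 : TFMat k k) - const A)⁻¹ * const B + const D

/-- The value at `s ∈ ℂ` (meaningful where no entry has a pole). -/
def evalAt {a b : ℕ} (M : TFMat a b) (s : ℂ) : Matrix (Fin a) (Fin b) ℂ :=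
  M.map fun r => RatFunc.eval (RingHom.id ℂ) s r

/-- A rational transfer matrix belongs to the Hardy space `H_∞` (of the right half-plane):
every entry is proper and has no pole in `Re s ≥ 0`. -/
def InHInf {a b : ℕ} (M : TFMat a b) : Prop :=
  ∀ i j, (M i j).num.degree ≤ (M i j).denom.degree ∧
    ∀ s : ℂ, 0 ≤ s.re → (M i j).denom.eval s ≠ 0

section Norm
open scoped Matrix.Norms.L2Operator

/-- The `H_∞` norm `sup_{Re s > 0} σ_max (M s)`. For a rational matrix that is improper or has a
pole in `Re s ≥ 0` the supremum is `∞`. -/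
def hInfNorm {a b : ℕ} (M : TFMat a b) : ℝ≥0∞ :=
  ⨆ (s : ℂ) (_ : 0 < s.re), ‖evalAt M s‖ₑ

end Norm

/-! ### Four-block plants and feedback -/

/-- All eigenvalues lie in the open left half-plane. -/
def Hurwitz {ι : Type} [Fintype ι] [DecidableEq ι] (A : Matrix ι ι ℂ) : Prop :=
  ∀ μ ∈ spectrum ℂ A, μ.re < 0

/-- State-space data of a four-block plant `(ϖ, v) ↦ (ζ, ξ)`, with `m` states,
`ϖ ∈ ℂ^nw`, `v ∈ ℂ^nv`, `ζ ∈ ℂ^nz`, `ξ ∈ ℂ^nx`. -/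
structure Plant (m nw nv nz nx : ℕ) where
  A : Matrix (Fin m) (Fin m) ℂ
  B₁ : Matrix (Fin m) (Fin nw) ℂ
  B₂ : Matrix (Fin m) (Fin nv) ℂ
  C₁ : Matrix (Fin nz) (Fin m) ℂ
  C₂ : Matrix (Fin nx) (Fin m) ℂ
  D₁₁ : Matrix (Fin nz) (Fin nw) ℂ
  D₁₂ : Matrix (Fin nz) (Fin nv) ℂ
  D₂₁ : Matrix (Fin nx) (Fin nw) ℂ
  D₂₂ : Matrix (Fin nx) (Fin nv) ℂ

namespace Plant

variable {m nw nv nz nx : ℕ}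

/-- The lower linear fractional transformation
`P₁₁ + P₁₂ K (I - P₂₂ K)⁻¹ P₂₁` of the plant and the feedback controller `v = K ξ`. -/
def lft (P : Plant m nw nv nz nx) (K : TFMat nv nx) : TFMat nz nw :=
  transfer P.A P.B₁ P.C₁ P.D₁₁ +
    transfer P.A P.B₂ P.C₁ P.D₁₂ * K * (1 - transfer P.A P.B₂ P.C₂ P.D₂₂ * K)⁻¹ *
      transfer P.A P.B₁ P.C₂ P.D₂₁

/-- The state matrix of the feedback interconnection (with `ϖ = 0`) of the plant and a controller
`ẋ' = a x' + b ξ`, `v = c x' + d ξ`. -/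
def closedLoop {k : ℕ} (P : Plant m nw nv nz nx)
    (a : Matrix (Fin k) (Fin k) ℂ) (b : Matrix (Fin k) (Fin nx) ℂ)
    (c : Matrix (Fin nv) (Fin k) ℂ) (d : Matrix (Fin nv) (Fin nx) ℂ) :
    Matrix (Fin m ⊕ Fin k) (Fin m ⊕ Fin k) ℂ :=
  let L : Matrix (Fin nx) (Fin nx) ℂ := (1 - P.D₂₂ * d)⁻¹
  Matrix.fromBlocks
    (P.A + P.B₂ * d * L * P.C₂) (P.B₂ * (c + d * L * P.D₂₂ * c))
    (b * L * P.C₂) (a + b * L * P.D₂₂ * c)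

/-- The controller `K` internally stabilizes the plant: the loop is well posed and, for a state
space realization of `K`, the joint state of plant and controller decays to zero from every
initial value. (A realization for which the closed-loop matrix is Hurwitz is automatically
stabilizable and detectable.) -/
def InternallyStabilizedBy (P : Plant m nw nv nz nx) (K : TFMat nv nx) : Prop :=
  ∃ (k : ℕ) (a : Matrix (Fin k) (Fin k) ℂ) (b : Matrix (Fin k) (Fin nx) ℂ)
    (c : Matrix (Fin nv) (Fin k) ℂ) (d : Matrix (Fin nv) (Fin nx) ℂ),
    K = transfer a b c d ∧ IsUnit (1 - P.D₂₂ * d) ∧ Hurwitz (P.closedLoop a b c d)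

/-- `K` solves the two-disk problem for the plant `P` with the level `γ` and the matrices
`V`, `W`, `J`: it is a rational element of `H_∞`, it internally stabilizes `P`, and
`‖F_l(P, K)‖_∞ < γ`, `‖V K W† - J‖_∞ < 1`. -/
def SolvesTwoDisk (P : Plant m nw nv nz nx) (γ : ℝ)
    (V : Matrix (Fin nv) (Fin nv) ℂ) (W : Matrix (Fin nx) (Fin nx) ℂ)
    (J : Matrix (Fin nv) (Fin nx) ℂ) (K : TFMat nv nx) : Prop :=
  InHInf K ∧ P.InternallyStabilizedBy K ∧ hInfNorm (P.lft K) < ENNReal.ofReal γ ∧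
    hInfNorm (const V * K * const Wᴴ - const J) < 1

/-- `H` solves the two-disk problem for the plant `P` in which the controller itself is required
to be strictly contractive: `H` is a rational element of `H_∞`, it internally stabilizes `P`, and
`‖F_l(P, H)‖_∞ < γ`, `‖H‖_∞ < 1`. -/
def SolvesContractiveTwoDisk (P : Plant m nw nv nz nx) (γ : ℝ) (H : TFMat nv nx) : Prop :=
  InHInf H ∧ P.InternallyStabilizedBy H ∧ hInfNorm (P.lft H) < ENNReal.ofReal γ ∧
    hInfNorm H < 1

end Plant

/-! ### The plant of the auxiliary problem -/

/-- State-space data of `Υ_λ = col (Υ_{1,λ}, Υ_{2,λ})`,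
`Υ_{j,λ}(s) = C_j (sI - A)⁻¹ B + D_j`, where `Υ_{1,λ}` is `ny × p` and `Υ_{2,λ}` is `n × p`. -/
structure FactorData (m p ny n : ℕ) where
  A : Matrix (Fin m) (Fin m) ℂ
  B : Matrix (Fin m) (Fin p) ℂ
  C₁ : Matrix (Fin ny) (Fin m) ℂ
  C₂ : Matrix (Fin n) (Fin m) ℂ
  D₁ : Matrix (Fin ny) (Fin p) ℂ
  D₂ : Matrix (Fin n) (Fin p) ℂ

/-- `γ̄ = (γ² + λ²)^{1/2}`. -/
def gammaBar (γ lam : ℝ) : ℝ := Real.sqrt (γ ^ 2 + lam ^ 2)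

/-- The `p × k` matrix `col (0, I_k)`, for `k ≤ p`: the entry `(i, j)` is `1` iff
`i = (p - k) + j`. -/
def zeroId (p k : ℕ) : Matrix (Fin p) (Fin k) ℂ :=
  Matrix.of fun i j => if (i : ℕ) + k = p + (j : ℕ) then 1 else 0

/-- The diagonal matrix with real diagonal entries `σ`. -/
def realDiag {k : ℕ} (σ : Fin k → ℝ) : Matrix (Fin k) (Fin k) ℂ :=
  Matrix.diagonal fun i => (σ i : ℂ)

section InvSqrt
open scoped MatrixOrder

/-- `R^{-1/2}`, the positive definite square root of `R⁻¹`, for a positive definite `R`. -/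
def invSqrt {k : ℕ} (R : Matrix (Fin k) (Fin k) ℂ) : Matrix (Fin k) (Fin k) ℂ :=
  CFC.sqrt R⁻¹

end InvSqrt

namespace FactorData

variable {m p ny n : ℕ} (Y : FactorData m p ny n)

/-- The plant `P` with blocks `[Ῡ₂ Ῡ₁; I 0]`, where `Ῡ_j(s) = Υ_{j,λ}(s^*)†`. -/
def plant : Plant m n ny p n where
  A := Y.Aᴴ
  B₁ := Y.C₂ᴴ
  B₂ := Y.C₁ᴴ
  C₁ := Y.Bᴴ
  C₂ := 0
  D₁₁ := Y.D₂ᴴ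
  D₁₂ := Y.D₁ᴴ
  D₂₁ := 1
  D₂₂ := 0

/-- `Ē₁ = D₁ D₁†`. -/
def E₁ : Matrix (Fin ny) (Fin ny) ℂ := Y.D₁ * Y.D₁ᴴ

/-- `I_p - D₁† Ē₁⁻¹ D₁`. -/
def projPerp : Matrix (Fin p) (Fin p) ℂ := 1 - Y.D₁ᴴ * Y.E₁⁻¹ * Y.D₁

/-- `J = Ē₁⁻¹ D₁ D₂†`. -/
def J : Matrix (Fin ny) (Fin n) ℂ := Y.E₁⁻¹ * Y.D₁ * Y.D₂ᴴ

/-- `S = γ̄⁻¹ W̄₁₂† (I - D₁† Ē₁⁻¹ D₁) D₂†`. -/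
def S (g : ℝ) (W12 : Matrix (Fin p) (Fin p) ℂ) : Matrix (Fin p) (Fin n) ℂ :=
  ((1 / g : ℝ) : ℂ) • (W12ᴴ * Y.projPerp * Y.D₂ᴴ)

/-- `R₁ = I - S† S`. -/
def R₁ (g : ℝ) (W12 : Matrix (Fin p) (Fin p) ℂ) : Matrix (Fin n) (Fin n) ℂ :=
  1 - (Y.S g W12)ᴴ * Y.S g W12

/-- `R₂ = I - S S†`. -/
def R₂ (g : ℝ) (W12 : Matrix (Fin p) (Fin p) ℂ) : Matrix (Fin p) (Fin p) ℂ :=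
  1 - Y.S g W12 * (Y.S g W12)ᴴ

/-- The loop-shifted plant in standard form. The argument `g` stands for `γ̄`; `V12`, `σ12`, `W12`
come from the singular value decomposition of `D₁`, and `W21`, `σ21` from that of `R₁^{-1/2}`. -/
def shiftedPlant (g : ℝ) (V12 : Matrix (Fin ny) (Fin ny) ℂ) (σ12 : Fin ny → ℝ)
    (W12 : Matrix (Fin p) (Fin p) ℂ) (W21 : Matrix (Fin n) (Fin n) ℂ) (σ21 : Fin n → ℝ) :
    Plant m n ny p n where
  A := Y.Aᴴ + ((1 / g ^ 2 : ℝ) : ℂ) •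
    ((Y.C₂ᴴ - Y.C₁ᴴ * Y.E₁⁻¹ * Y.D₁ * Y.D₂ᴴ) * (Y.R₁ g W12)⁻¹ * Y.D₂ * Y.projPerp * Y.Bᴴ)
  B₁ := ((1 / g : ℝ) : ℂ) •
    ((Y.C₂ᴴ - Y.C₁ᴴ * Y.E₁⁻¹ * Y.D₁ * Y.D₂ᴴ) * W21 * realDiag σ21)
  B₂ := Y.C₁ᴴ * V12 * (realDiag σ12)⁻¹
  C₁ := invSqrt (Y.R₂ g W12) * W12ᴴ * Y.Bᴴ
  C₂ := ((1 / g : ℝ) : ℂ) •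
    (W21ᴴ * invSqrt (Y.R₁ g W12) * Y.D₂ * Y.projPerp * Y.Bᴴ)
  D₁₁ := 0
  D₁₂ := zeroId p ny
  D₂₁ := 1
  D₂₂ := 0

/-- `V = γ̄ V̄₁₂ Σ̄₁₂⁻¹`. -/
def V (g : ℝ) (V12 : Matrix (Fin ny) (Fin ny) ℂ) (σ12 : Fin ny → ℝ) :
    Matrix (Fin ny) (Fin ny) ℂ :=
  (g : ℂ) • (V12 * (realDiag σ12)⁻¹)

/-- `W = W̄₂₁ Σ̄₂₁⁻¹`. -/
def W (W21 : Matrix (Fin n) (Fin n) ℂ) (σ21 : Fin n → ℝ) : Matrix (Fin n) (Fin n) ℂ :=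
  W21 * (realDiag σ21)⁻¹

/-- `H̄₁₁ = γ̄ V̄₁₂ Σ̄₁₂⁻¹ 𝒞 Σ̄₂₁⁻¹ W̄₂₁† - Ē₁⁻¹ D₁ D₂†`. -/
def hBar (g : ℝ) (V12 : Matrix (Fin ny) (Fin ny) ℂ) (σ12 : Fin ny → ℝ)
    (W21 : Matrix (Fin n) (Fin n) ℂ) (σ21 : Fin n → ℝ) (K : TFMat ny n) : TFMat ny n :=
  const ((g : ℂ) • (V12 * (realDiag σ12)⁻¹)) * K * const ((realDiag σ21)⁻¹ * W21ᴴ)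
    - const (Y.E₁⁻¹ * Y.D₁ * Y.D₂ᴴ)

end FactorData

end TwoDisk

end

open TwoDisk

open Matrix
open scoped ENNReal ComplexOrder

noncomputable section

namespace TwoDisk

/-! ### Rational matrices and their values at a regular point. -/

/-- The local ring of rational functions without a pole at `s`. -/
def regularAt (s : ℂ) : Subring (RatFunc ℂ) where
  carrier := {r | r.denom.eval s ≠ 0}
  mul_mem' {a b} ha hb h := by
    obtain ⟨c, hc⟩ := RatFunc.denom_mul_dvd a b
    have := congrArg (Polynomial.eval s) hc
    rw [Polynomial.eval_mul, Polynomial.eval_mul, h, zero_mul] at this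
    exact mul_ne_zero ha hb this
  one_mem' := by simp
  add_mem' {a b} ha hb h := by
    obtain ⟨c, hc⟩ := RatFunc.denom_add_dvd a b
    have := congrArg (Polynomial.eval s) hc
    rw [Polynomial.eval_mul, Polynomial.eval_mul, h, zero_mul] at this
    exact mul_ne_zero ha hb this
  zero_mem' := by simp
  neg_mem' {a} ha h := by
    have e : -a = RatFunc.C (-1) * a := by simp
    obtain ⟨c, hc⟩ := RatFunc.denom_mul_dvd (RatFunc.C (-1)) a
    have := congrArg (Polynomial.eval s) hc
    rw [Polynomial.eval_mul, Polynomial.eval_mul, ← e, h, zero_mul, RatFunc.denom_C] at this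
    simp at this
    exact ha this

theorem mem_regularAt {s : ℂ} {r : RatFunc ℂ} : r ∈ regularAt s ↔ r.denom.eval s ≠ 0 := Iff.rfl

/-- Evaluation at `s` on the rational functions without a pole at `s`. -/
def regularEval (s : ℂ) : regularAt s →+* ℂ where
  toFun r := RatFunc.eval (RingHom.id ℂ) s r
  map_one' := by simp
  map_zero' := by simp
  map_mul' a b := RatFunc.eval_mul _ _ a.2 b.2
  map_add' a b := RatFunc.eval_add _ _ a.2 b.2

theorem regularEval_apply {s : ℂ} (r : regularAt s) :
    regularEval s r = RatFunc.eval (RingHom.id ℂ) s r := rfl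

theorem C_mem_regularAt (s c : ℂ) : RatFunc.C c ∈ regularAt s := by
  simp [mem_regularAt, RatFunc.denom_C]

theorem X_mem_regularAt (s : ℂ) : (RatFunc.X : RatFunc ℂ) ∈ regularAt s := by
  simp [mem_regularAt]

/-- A nonzero value means that the numerator does not vanish at `s`, and the denominator of the
inverse divides that numerator. -/
theorem isUnit_of_regularEval_ne_zero {s : ℂ} {r : regularAt s} (h : regularEval s r ≠ 0) :
    IsUnit r := by
  have h0 : (r : RatFunc ℂ) ≠ 0 := by
    intro h'
    exact h (by rw [regularEval_apply, h', RatFunc.eval_zero])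
  have hn : (r : RatFunc ℂ).num.eval s ≠ 0 := by
    intro h'
    apply h
    rw [regularEval_apply, RatFunc.eval, Polynomial.eval₂_id, h', zero_div]
  have hinv : (r : RatFunc ℂ)⁻¹ ∈ regularAt s := by
    intro h'
    obtain ⟨c, hc⟩ := RatFunc.denom_inv_dvd h0
    exact hn (by rw [hc, Polynomial.eval_mul, h', zero_mul])
  exact IsUnit.of_mul_eq_one ⟨_, hinv⟩ (Subtype.ext (mul_inv_cancel₀ h0))

section Regular

variable {ι κ μ : Type*} {s : ℂ}

/-- The value at `s` of a matrix of rational functions. -/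
def matEval (s : ℂ) (M : Matrix ι κ (RatFunc ℂ)) : Matrix ι κ ℂ :=
  M.map fun r => RatFunc.eval (RingHom.id ℂ) s r

/-- A complex matrix regarded as a constant matrix of rational functions. -/
def matConst (M : Matrix ι κ ℂ) : Matrix ι κ (RatFunc ℂ) := M.map RatFunc.C

/-- No entry of the matrix has a pole at `s`. -/
def MatRegular (s : ℂ) (M : Matrix ι κ (RatFunc ℂ)) : Prop :=
  ∃ N : Matrix ι κ (regularAt s), M = N.map (regularAt s).subtype

/-- Regularity is defined as a lift to `regularAt s`, so that sums, products and evaluation reduce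
to ring homomorphisms; the entrywise form links it to `InHInf`. -/
theorem matRegular_iff {M : Matrix ι κ (RatFunc ℂ)} :
    MatRegular s M ↔ ∀ i j, (M i j).denom.eval s ≠ 0 := by
  constructor
  · rintro ⟨N, rfl⟩ i j
    exact (N i j).2
  · intro h
    exact ⟨Matrix.of fun i j => ⟨M i j, h i j⟩, rfl⟩

theorem matEval_lift (N : Matrix ι κ (regularAt s)) :
    matEval s (N.map (regularAt s).subtype) = N.map (regularEval s) := rfl

theorem matRegular_const (M : Matrix ι κ ℂ) : MatRegular s (matConst M) :=
  matRegular_iff.2 fun i j => C_mem_regularAt s (M i j)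

theorem matEval_const (M : Matrix ι κ ℂ) : matEval s (matConst M) = M := by
  ext i j
  simp [matEval, matConst, RatFunc.eval_C]

theorem MatRegular.add {M N : Matrix ι κ (RatFunc ℂ)} (hM : MatRegular s M)
    (hN : MatRegular s N) : MatRegular s (M + N) := by
  obtain ⟨M, rfl⟩ := hM
  obtain ⟨N, rfl⟩ := hN
  exact ⟨M + N, (Matrix.map_add _ (map_add _) _ _).symm⟩

theorem MatRegular.sub {M N : Matrix ι κ (RatFunc ℂ)} (hM : MatRegular s M)
    (hN : MatRegular s N) : MatRegular s (M - N) := by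
  obtain ⟨M, rfl⟩ := hM
  obtain ⟨N, rfl⟩ := hN
  exact ⟨M - N, (Matrix.map_sub _ (map_sub _) _ _).symm⟩

theorem MatRegular.mul [Fintype κ] {M : Matrix ι κ (RatFunc ℂ)} {N : Matrix κ μ (RatFunc ℂ)}
    (hM : MatRegular s M) (hN : MatRegular s N) : MatRegular s (M * N) := by
  obtain ⟨M, rfl⟩ := hM
  obtain ⟨N, rfl⟩ := hN
  exact ⟨M * N, Matrix.map_mul.symm⟩

theorem matEval_add {M N : Matrix ι κ (RatFunc ℂ)} (hM : MatRegular s M)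
    (hN : MatRegular s N) : matEval s (M + N) = matEval s M + matEval s N := by
  obtain ⟨M, rfl⟩ := hM
  obtain ⟨N, rfl⟩ := hN
  rw [← Matrix.map_add _ (map_add _), matEval_lift, matEval_lift, matEval_lift,
    ← Matrix.map_add _ (map_add _)]

theorem matEval_sub {M N : Matrix ι κ (RatFunc ℂ)} (hM : MatRegular s M)
    (hN : MatRegular s N) : matEval s (M - N) = matEval s M - matEval s N := by
  obtain ⟨M, rfl⟩ := hM
  obtain ⟨N, rfl⟩ := hN
  rw [← Matrix.map_sub _ (map_sub _), matEval_lift, matEval_lift, matEval_lift,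
    ← Matrix.map_sub _ (map_sub _)]

theorem matEval_mul [Fintype κ] {M : Matrix ι κ (RatFunc ℂ)} {N : Matrix κ μ (RatFunc ℂ)}
    (hM : MatRegular s M) (hN : MatRegular s N) :
    matEval s (M * N) = matEval s M * matEval s N := by
  obtain ⟨M, rfl⟩ := hM
  obtain ⟨N, rfl⟩ := hN
  rw [← Matrix.map_mul, matEval_lift, matEval_lift, matEval_lift, Matrix.map_mul]

theorem matConst_mul [Fintype κ] (M : Matrix ι κ ℂ) (N : Matrix κ μ ℂ) :
    matConst (M * N) = matConst M * matConst N := Matrix.map_mul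

theorem matConst_add (M N : Matrix ι κ ℂ) : matConst (M + N) = matConst M + matConst N :=
  Matrix.map_add _ (map_add _) _ _

theorem matConst_sub (M N : Matrix ι κ ℂ) : matConst (M - N) = matConst M - matConst N :=
  Matrix.map_sub _ (map_sub _) _ _

theorem matConst_zero : matConst (0 : Matrix ι κ ℂ) = 0 := Matrix.map_zero _ (map_zero _)

section Square

variable [DecidableEq ι]

theorem matConst_one : matConst (1 : Matrix ι ι ℂ) = 1 :=
  Matrix.map_one _ (map_zero _) (map_one _)

theorem matRegular_X_smul_one :
    MatRegular s ((RatFunc.X : RatFunc ℂ) • (1 : Matrix ι ι (RatFunc ℂ))) :=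
  ⟨(⟨RatFunc.X, X_mem_regularAt s⟩ : regularAt s) • 1, by
    ext i j
    by_cases h : i = j <;> simp [h]⟩

theorem matRegular_one : MatRegular s (1 : Matrix ι ι (RatFunc ℂ)) :=
  matConst_one (ι := ι) ▸ matRegular_const 1

theorem matEval_one : matEval s (1 : Matrix ι ι (RatFunc ℂ)) = 1 := by
  rw [← matConst_one, matEval_const]

/-- The matrix `sI - A` over the rational functions. -/
def pencil (A : Matrix ι ι ℂ) : Matrix ι ι (RatFunc ℂ) :=
  (RatFunc.X : RatFunc ℂ) • (1 : Matrix ι ι (RatFunc ℂ)) - matConst A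

theorem matRegular_pencil (A : Matrix ι ι ℂ) : MatRegular s (pencil A) :=
  matRegular_X_smul_one.sub (matRegular_const A)

theorem matEval_pencil (A : Matrix ι ι ℂ) : matEval s (pencil A) = s • 1 - A := by
  rw [pencil, matEval_sub matRegular_X_smul_one (matRegular_const A), matEval_const]
  congr 1
  ext i j
  by_cases h : i = j <;> simp [h, matEval]

variable [Fintype ι]

/-- A matrix which is regular at `s` with an invertible value there is invertible, and its inverse
is regular at `s`. -/
theorem MatRegular.exists_inverse {M : Matrix ι ι (RatFunc ℂ)} (hM : MatRegular s M)
    (h : IsUnit (matEval s M)) : IsUnit M.det ∧ MatRegular s M⁻¹ := by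
  obtain ⟨N, rfl⟩ := hM
  rw [matEval_lift, Matrix.isUnit_iff_isUnit_det] at h
  have hd : (N.map (regularEval s)).det = regularEval s N.det :=
    (RingHom.map_det (regularEval s) N).symm
  rw [hd] at h
  have hu : IsUnit N.det := isUnit_of_regularEval_ne_zero h.ne_zero
  have hmul : N.map (regularAt s).subtype * N⁻¹.map (regularAt s).subtype = 1 := by
    rw [← Matrix.map_mul, Matrix.mul_nonsing_inv _ hu]
    exact Matrix.map_one _ (map_zero _) (map_one _)
  refine ⟨Matrix.isUnit_det_of_right_inverse hmul, N⁻¹, ?_⟩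
  rw [Matrix.inv_eq_right_inv hmul]

/-- The characteristic polynomial has finitely many roots and ℂ is infinite. -/
theorem exists_isUnit_pencil_eval (A : Matrix ι ι ℂ) : ∃ s : ℂ, IsUnit (s • 1 - A) := by
  obtain ⟨s, hs⟩ := Polynomial.exists_eval_ne_zero_of_natDegree_lt_card A.charpoly
    A.charpoly_monic.ne_zero (lt_of_lt_of_le Cardinal.natCast_lt_aleph0 (Cardinal.aleph0_le_mk ℂ))
  refine ⟨s, ?_⟩
  rw [Matrix.isUnit_iff_isUnit_det, isUnit_iff_ne_zero]
  rwa [Matrix.eval_charpoly, Matrix.scalar_apply, ← Matrix.smul_one_eq_diagonal] at hs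

/-- Invertibility at a single point of ℂ already gives invertibility over the field of rational
functions. -/
theorem isUnit_det_pencil (A : Matrix ι ι ℂ) : IsUnit (pencil A).det := by
  obtain ⟨s, hs⟩ := exists_isUnit_pencil_eval A
  exact ((matRegular_pencil (s := s) A).exists_inverse (by rwa [matEval_pencil])).1

end Square

end Regular

/-! ### Hurwitz matrices and the ring H_∞. -/

/-- A matrix is Hurwitz iff its resolvent set contains the closed right half-plane. -/
theorem hurwitz_iff {ι : Type} [Fintype ι] [DecidableEq ι] {A : Matrix ι ι ℂ} :
    Hurwitz A ↔ ∀ s : ℂ, 0 ≤ s.re → IsUnit (s • 1 - A) := by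
  unfold Hurwitz
  constructor
  · intro h s hs
    by_contra hn
    exact absurd (h s (by rwa [spectrum.mem_iff, Algebra.algebraMap_eq_smul_one])) (not_lt.2 hs)
  · intro h s hs
    by_contra hn
    rw [spectrum.mem_iff, Algebra.algebraMap_eq_smul_one] at hs
    exact hs (h s (not_lt.1 hn))

/-- A matrix is Hurwitz iff its adjoint is. -/
theorem Hurwitz.conjTranspose {ι : Type} [Fintype ι] [DecidableEq ι] {A : Matrix ι ι ℂ}
    (h : Hurwitz A) : Hurwitz Aᴴ := by
  rw [hurwitz_iff] at h ⊢
  intro s hs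
  have := (h (star s) (by simpa using hs)).star
  rw [star_sub, star_smul, star_star, star_one] at this
  exact this

section HInf

variable {a b c k : ℕ} {s : ℂ}

theorem InHInf.matRegular {M : TFMat a b} (h : InHInf M) (hs : 0 ≤ s.re) : MatRegular s M :=
  matRegular_iff.2 fun i j => (h i j).2 s hs

/-- `RatFunc.intDegree` behaves like a valuation, so in this form properness is visibly closed under
sums and products. The zero function fits because its `intDegree` is 0. -/
theorem num_degree_le_iff (r : RatFunc ℂ) :
    r.num.degree ≤ r.denom.degree ↔ r.intDegree ≤ 0 := by
  rcases eq_or_ne r 0 with rfl | h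
  · simp
  · rw [Polynomial.degree_eq_natDegree (RatFunc.num_ne_zero h),
      Polynomial.degree_eq_natDegree r.denom_ne_zero, RatFunc.intDegree]
    simp

/-- The ring of proper rational functions. -/
def properSubring : Subring (RatFunc ℂ) where
  carrier := {r | r.intDegree ≤ 0}
  mul_mem' {x y} hx hy := by
    simp only [Set.mem_ofPred_eq] at *
    rcases eq_or_ne x 0 with rfl | h
    · simp
    rcases eq_or_ne y 0 with rfl | h'
    · simp
    rw [RatFunc.intDegree_mul h h']
    omega
  one_mem' := by simp
  add_mem' {x y} hx hy := by
    simp only [Set.mem_ofPred_eq] at *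
    rcases eq_or_ne y 0 with rfl | h
    · simpa using hx
    rcases eq_or_ne (x + y) 0 with h' | h'
    · rw [h']; simp
    exact (RatFunc.intDegree_add_le h h').trans (max_le hx hy)
  zero_mem' := by simp
  neg_mem' {x} hx := by
    simp only [Set.mem_ofPred_eq] at *
    rwa [RatFunc.intDegree_neg]

/-- `H_∞` as a subring of the rational functions. -/
def hInfSubring : Subring (RatFunc ℂ) :=
  properSubring ⊓ ⨅ (s : ℂ) (_ : 0 ≤ s.re), regularAt s

theorem inHInf_iff {M : TFMat a b} : InHInf M ↔ ∀ i j, M i j ∈ hInfSubring := by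
  simp only [InHInf, hInfSubring, Subring.mem_inf, Subring.mem_iInf, num_degree_le_iff]
  rfl

theorem inHInf_const (M : Matrix (Fin a) (Fin b) ℂ) : InHInf (const M) := by
  intro i j
  rw [num_degree_le_iff]
  exact ⟨by simp [const], fun s _ => C_mem_regularAt s (M i j)⟩

theorem InHInf.add {M N : TFMat a b} (hM : InHInf M) (hN : InHInf N) : InHInf (M + N) := by
  rw [inHInf_iff] at *
  exact fun i j => add_mem (hM i j) (hN i j)

theorem InHInf.sub {M N : TFMat a b} (hM : InHInf M) (hN : InHInf N) : InHInf (M - N) := by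
  rw [inHInf_iff] at *
  exact fun i j => sub_mem (hM i j) (hN i j)

theorem InHInf.mul {M : TFMat a b} {N : TFMat b c} (hM : InHInf M) (hN : InHInf N) :
    InHInf (M * N) := by
  rw [inHInf_iff] at *
  intro i j
  rw [Matrix.mul_apply]
  exact sum_mem fun l _ => mul_mem (hM i l) (hN l j)

end HInf

/-! ### Pointwise bounds, poles and the H_∞ norm. -/

theorem continuousAt_matEval {ι κ : Type*} {s : ℂ} {M : Matrix ι κ (RatFunc ℂ)}
    (h : MatRegular s M) : ContinuousAt (fun z => matEval z M) s := by
  rw [matRegular_iff] at h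
  refine continuousAt_pi.2 fun i => continuousAt_pi.2 fun j => ?_
  simp only [matEval, Matrix.map_apply, RatFunc.eval, Polynomial.eval₂_id]
  exact (Polynomial.continuous _).continuousAt.div (Polynomial.continuous _).continuousAt (h i j)

/-- A rational matrix has finitely many poles. -/
theorem finite_setOf_not_matRegular {ι κ : Type*} [Finite ι] [Finite κ]
    (M : Matrix ι κ (RatFunc ℂ)) : {s | ¬ MatRegular s M}.Finite := by
  have : {s | ¬ MatRegular s M} ⊆ ⋃ i, ⋃ j, {s | (M i j).denom.IsRoot s} := by
    intro s hs
    simp only [Set.mem_ofPred_eq, matRegular_iff, not_forall, not_not] at hs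
    obtain ⟨i, j, h⟩ := hs
    exact Set.mem_iUnion.2 ⟨i, Set.mem_iUnion.2 ⟨j, h⟩⟩
  exact (Set.finite_iUnion fun i => Set.finite_iUnion fun j =>
    Polynomial.finite_setOfPred_isRoot (RatFunc.denom_ne_zero _)).subset this

section Norm
open scoped Matrix.Norms.L2Operator

/-- The Euclidean norm of a complex tuple. -/
def eucNorm {ι : Type*} [Fintype ι] (v : ι → ℂ) : ℝ := ‖WithLp.toLp 2 v‖

variable {ι κ : Type*} [Fintype ι] [Fintype κ]

theorem eucNorm_nonneg (v : ι → ℂ) : 0 ≤ eucNorm v := norm_nonneg _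

theorem eucNorm_eq_zero {v : ι → ℂ} : eucNorm v = 0 ↔ v = 0 := by
  simp [eucNorm]

theorem eucNorm_add_le (v w : ι → ℂ) : eucNorm (v + w) ≤ eucNorm v + eucNorm w :=
  norm_add_le (WithLp.toLp 2 v) (WithLp.toLp 2 w)

theorem eucNorm_sq (v : ι → ℂ) : ((eucNorm v ^ 2 : ℝ) : ℂ) = star v ⬝ᵥ v := by
  rw [eucNorm, EuclideanSpace.norm_sq_eq, dotProduct]
  push_cast
  refine Finset.sum_congr rfl fun i _ => ?_
  simp [Complex.conj_mul']

theorem eucNorm_mulVec_sq (N : Matrix ι κ ℂ) (w : κ → ℂ) :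
    ((eucNorm (N *ᵥ w) ^ 2 : ℝ) : ℂ) = star w ⬝ᵥ ((Nᴴ * N) *ᵥ w) := by
  rw [eucNorm_sq, star_mulVec, ← dotProduct_mulVec, mulVec_mulVec]

variable [DecidableEq κ]

theorem eucNorm_mulVec_le (A : Matrix ι κ ℂ) (v : κ → ℂ) :
    eucNorm (A *ᵥ v) ≤ ‖A‖ * eucNorm v :=
  l2_opNorm_mulVec A (WithLp.toLp 2 v)

theorem norm_le_of_eucNorm_mulVec_le {A : Matrix ι κ ℂ} {c : ℝ} (hc : 0 ≤ c)
    (h : ∀ v, eucNorm (A *ᵥ v) ≤ c * eucNorm v) : ‖A‖ ≤ c := by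
  rw [l2_opNorm_def]
  exact ContinuousLinearMap.opNorm_le_bound _ hc fun v => h v.ofLp

/-- `‖M‖_∞ < r` iff `M` is bounded by some constant less than `r` on the open right half-plane. -/
theorem hInfNorm_lt_iff {a b : ℕ} {M : TFMat a b} {r : ℝ} (hr : 0 < r) :
    hInfNorm M < ENNReal.ofReal r ↔
      ∃ c, 0 ≤ c ∧ c < r ∧ ∀ s : ℂ, 0 < s.re → ‖matEval s M‖ ≤ c := by
  constructor
  · intro h
    have ht : hInfNorm M ≠ ⊤ := h.ne_top
    refine ⟨(hInfNorm M).toReal, ENNReal.toReal_nonneg, ?_, fun s hs => ?_⟩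
    · exact (ENNReal.lt_ofReal_iff_toReal_lt ht).1 h
    · have : ‖matEval s M‖ₑ ≤ hInfNorm M := le_iSup₂ (f := fun (s : ℂ) (_ : 0 < s.re) =>
        ‖evalAt M s‖ₑ) s hs
      rw [← toReal_enorm]
      exact ENNReal.toReal_mono ht this
  · rintro ⟨c, hc, hcr, h⟩
    refine lt_of_le_of_lt (iSup₂_le fun s hs => ?_) ((ENNReal.ofReal_lt_ofReal_iff hr).2 hcr)
    rw [← ofReal_norm]
    exact ENNReal.ofReal_le_ofReal (h s hs)

/-- A bound on the open right half-plane off a finite set extends to every regular point of the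
closed right half-plane. -/
theorem norm_matEval_le {M : Matrix ι κ (RatFunc ℂ)} {F : Set ℂ} (hF : F.Finite) {c : ℝ}
    (h : ∀ s : ℂ, 0 < s.re → s ∉ F → ‖matEval s M‖ ≤ c) {s : ℂ} (hs : 0 ≤ s.re)
    (hM : MatRegular s M) : ‖matEval s M‖ ≤ c := by
  -- Approach `s` horizontally from the right: these points lie in the open half-plane even when `s`
  -- is on the imaginary axis.
  have ht : Filter.Tendsto (fun t : ℝ => s + t) (nhdsWithin 0 (Set.Ioi 0)) (nhds s) := by
    have : Filter.Tendsto (fun t : ℝ => s + t) (nhds 0) (nhds (s + (0 : ℝ))) :=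
      (continuous_const.add Complex.continuous_ofReal).tendsto 0
    simp only [Complex.ofReal_zero, add_zero] at this
    exact this.mono_left nhdsWithin_le_nhds
  have hc := ((continuousAt_matEval hM).tendsto.comp ht).norm
  refine le_of_tendsto hc ?_
  have hfin : ((fun t : ℝ => s + t) ⁻¹' F).Finite :=
    hF.preimage (fun x _ y _ hxy => by simpa using hxy)
  have h1 : ∀ᶠ t : ℝ in nhdsWithin 0 (Set.Ioi 0), t ∉ (fun t : ℝ => s + t) ⁻¹' F := by
    -- The point `s` may itself belong to `F`, so `t = 0` is removed before taking the open
    -- complement.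
    have : ((fun t : ℝ => s + t) ⁻¹' F \ {0})ᶜ ∈ nhds (0 : ℝ) :=
      (hfin.subset Set.sdiff_subset).isClosed.isOpen_compl.mem_nhds (by simp)
    filter_upwards [nhdsWithin_le_nhds this, self_mem_nhdsWithin] with t h1 h2 h3
    exact h1 ⟨h3, ne_of_gt h2⟩
  filter_upwards [h1, self_mem_nhdsWithin] with t h1 h2
  refine h _ ?_ h1
  have : 0 < t := h2
  simp
  linarith

end Norm

/-! ### The energy identity of the loop shift and uniform contractivity. -/

section Energy
open scoped Matrix.Norms.L2Operator

variable {ι κ : Type*} [Fintype ι] [Fintype κ] [DecidableEq ι] [DecidableEq κ]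

/-- Data of a loop shift: a strict contraction `S` together with invertible factors of the inverse
defect matrices `(1 - S†S)⁻¹ = U†U` and `(1 - SS†)⁻¹ = Q†Q`. -/
structure LoopShift (S : Matrix ι κ ℂ) (U : Matrix κ κ ℂ) (Q : Matrix ι ι ℂ) : Prop where
  left : Uᴴ * U * (1 - Sᴴ * S) = 1
  right : Qᴴ * Q * (1 - S * Sᴴ) = 1

variable {S : Matrix ι κ ℂ} {U : Matrix κ κ ℂ} {Q : Matrix ι ι ℂ}

namespace LoopShift

/-- The map (w, Mw) ↦ (U(w - S†Mw), Q(Mw - S w)) preserves the indefinite form |·|² - |·|². After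
expansion the cross terms cancel by the push-through identity S(1 - S†S)⁻¹ = (1 - SS†)⁻¹S, and the
diagonal terms reduce to 1 and -M†M. -/
theorem energy (h : LoopShift S U Q) (M : Matrix ι κ ℂ) :
    (U * (1 - Sᴴ * M))ᴴ * (U * (1 - Sᴴ * M)) - (Q * (M - S))ᴴ * (Q * (M - S)) = 1 - Mᴴ * M := by
  have hl := h.left
  have hr := h.right
  have hl' : (1 - Sᴴ * S) * (Uᴴ * U) = 1 := mul_eq_one_comm.1 hl
  have hr' : (1 - S * Sᴴ) * (Qᴴ * Q) = 1 := mul_eq_one_comm.1 hr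
  set A := Uᴴ * U
  set B := Qᴴ * Q
  have hSA : S * A = B * S := by
    calc S * A = B * (1 - S * Sᴴ) * S * A := by rw [hr, Matrix.one_mul]
      _ = B * S * ((1 - Sᴴ * S) * A) := by
        simp only [Matrix.mul_sub, Matrix.sub_mul, Matrix.mul_one, Matrix.one_mul, Matrix.mul_assoc]
      _ = B * S := by rw [hl', Matrix.mul_one]
  have hAS : A * Sᴴ = Sᴴ * B := by
    calc A * Sᴴ = A * Sᴴ * ((1 - S * Sᴴ) * B) := by rw [hr', Matrix.mul_one]
      _ = A * (1 - Sᴴ * S) * Sᴴ * B := by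
        simp only [Matrix.mul_sub, Matrix.sub_mul, Matrix.mul_one, Matrix.one_mul, Matrix.mul_assoc]
      _ = Sᴴ * B := by rw [hl, Matrix.one_mul]
  have e1 : A - Sᴴ * B * S = 1 := by
    rw [← hAS, ← hl, Matrix.mul_sub, Matrix.mul_one, Matrix.mul_assoc]
  have e2 : S * A * Sᴴ - B = -1 := by
    rw [hSA, ← hr, Matrix.mul_sub, Matrix.mul_one, Matrix.mul_assoc, neg_sub]
  calc (U * (1 - Sᴴ * M))ᴴ * (U * (1 - Sᴴ * M)) - (Q * (M - S))ᴴ * (Q * (M - S))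
      = (1 - Mᴴ * S) * A * (1 - Sᴴ * M) - (Mᴴ - Sᴴ) * B * (M - S) := by
        simp only [conjTranspose_mul, conjTranspose_sub, conjTranspose_one,
          conjTranspose_conjTranspose, A, B, Matrix.mul_assoc]
    _ = (A - Sᴴ * B * S) + Mᴴ * (S * A * Sᴴ - B) * M - (A * Sᴴ - Sᴴ * B) * M
          - Mᴴ * (S * A - B * S) := by
        simp only [Matrix.mul_sub, Matrix.sub_mul, Matrix.mul_one, Matrix.one_mul, Matrix.mul_assoc]
        abel
    _ = 1 - Mᴴ * M := by 
        rw [e1, e2, hSA, hAS]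
        simp [sub_eq_add_neg]

theorem energy_mulVec (h : LoopShift S U Q) (M : Matrix ι κ ℂ) (w : κ → ℂ) :
    eucNorm ((U * (1 - Sᴴ * M)) *ᵥ w) ^ 2 - eucNorm ((Q * (M - S)) *ᵥ w) ^ 2 =
      eucNorm w ^ 2 - eucNorm (M *ᵥ w) ^ 2 := by
  have e := congrArg (fun N => star w ⬝ᵥ (N *ᵥ w)) (h.energy M)
  simp only [sub_mulVec, dotProduct_sub, one_mulVec] at e
  simp only [← eucNorm_mulVec_sq, ← eucNorm_sq] at e
  exact_mod_cast e

/-- On a kernel vector the left side of the energy identity is at most 0, while |w|² - |Mw|² is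
positive unless w = 0. -/
theorem injective_of_norm_lt_one (h : LoopShift S U Q) {M : Matrix ι κ ℂ} (hM : ‖M‖ < 1)
    {w : κ → ℂ} (hw : (U * (1 - Sᴴ * M)) *ᵥ w = 0) : w = 0 := by
  have e := h.energy_mulVec M w
  rw [hw, eucNorm_eq_zero.2 rfl] at e
  by_contra hne
  have hpos : 0 < eucNorm w := lt_of_le_of_ne (eucNorm_nonneg w)
    (fun h => hne (eucNorm_eq_zero.1 h.symm))
  have h1 : eucNorm (M *ᵥ w) < eucNorm w := (eucNorm_mulVec_le M w).trans_lt (by nlinarith)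
  nlinarith [eucNorm_nonneg (M *ᵥ w), sq_nonneg (eucNorm ((Q * (M - S)) *ᵥ w))]

theorem isUnit_of_norm_lt_one (h : LoopShift S U Q) {M : Matrix ι κ ℂ} (hM : ‖M‖ < 1) :
    IsUnit (U * (1 - Sᴴ * M)) := by
  rw [Matrix.isUnit_iff_isUnit_det, isUnit_iff_ne_zero]
  intro h0
  obtain ⟨v, hv, hv'⟩ := exists_mulVec_eq_zero_iff.2 h0
  exact hv (h.injective_of_norm_lt_one hM hv')

/-- Uniform contractivity passes from `M` to its loop-shifted transform. -/
theorem exists_bound_shifted (h : LoopShift S U Q) {c : ℝ} (hc : 0 ≤ c) (hc1 : c < 1) :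
    ∃ d, 0 ≤ d ∧ d < 1 ∧ ∀ M T : Matrix ι κ ℂ, T * (U * (1 - Sᴴ * M)) = Q * (M - S) →
      ‖M‖ ≤ c → ‖T‖ ≤ d := by
  -- With u = U(1 - S†M)w one has |u| ≤ r|w|. Hence |u|² - |Tu|² = |w|² - |Mw|² ≥ (1 - c²)|w|² ≥ (1
  -- - c²)/r² · |u|², which dictates the bound for T. The summand 1 gives r ≥ 1 and keeps the
  -- radicand nonnegative.
  set r := ‖U‖ * (‖(1 : Matrix κ κ ℂ)‖ + ‖Sᴴ‖) + 1
  have hr : 1 ≤ r := le_add_of_nonneg_left (by positivity)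
  have hq : 0 < (1 - c ^ 2) / r ^ 2 := div_pos (by nlinarith) (by positivity)
  have hq1 : (1 - c ^ 2) / r ^ 2 ≤ 1 := by
    rw [div_le_one (by positivity)]
    nlinarith
  refine ⟨Real.sqrt (1 - (1 - c ^ 2) / r ^ 2), Real.sqrt_nonneg _, ?_, fun M T hT hM => ?_⟩
  · rw [Real.sqrt_lt' one_pos]
    linarith
  refine norm_le_of_eucNorm_mulVec_le (Real.sqrt_nonneg _) fun u => ?_
  have hu := h.isUnit_of_norm_lt_one (hM.trans_lt hc1)
  obtain ⟨w, rfl⟩ : ∃ w, (U * (1 - Sᴴ * M)) *ᵥ w = u :=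
    (Matrix.mulVec_surjective_iff_isUnit.2 hu) u
  have e := h.energy_mulVec M w
  rw [mulVec_mulVec, hT]
  have h1 : eucNorm (M *ᵥ w) ≤ c * eucNorm w := (eucNorm_mulVec_le M w).trans
    (mul_le_mul_of_nonneg_right hM (eucNorm_nonneg w))
  have h2 : eucNorm ((U * (1 - Sᴴ * M)) *ᵥ w) ≤ r * eucNorm w := by
    refine (eucNorm_mulVec_le _ w).trans (mul_le_mul_of_nonneg_right ?_ (eucNorm_nonneg w))
    have h3 : ‖1 - Sᴴ * M‖ ≤ ‖(1 : Matrix κ κ ℂ)‖ + ‖Sᴴ‖ :=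
      (norm_sub_le _ _).trans (add_le_add le_rfl ((l2_opNorm_mul _ _).trans
        (mul_le_of_le_one_right (norm_nonneg _) (hM.trans hc1.le))))
    exact (l2_opNorm_mul _ _).trans ((mul_le_mul_of_nonneg_left h3 (norm_nonneg _)).trans
      (le_add_of_nonneg_right zero_le_one))
  refine (pow_le_pow_iff_left₀ (eucNorm_nonneg _)
    (mul_nonneg (Real.sqrt_nonneg _) (eucNorm_nonneg _)) two_ne_zero).1 ?_
  rw [mul_pow, Real.sq_sqrt (by linarith)]
  have h1' : eucNorm (M *ᵥ w) ^ 2 ≤ c ^ 2 * eucNorm w ^ 2 := by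
    rw [← mul_pow]
    exact pow_le_pow_left₀ (eucNorm_nonneg _) h1 2
  have h2' : eucNorm ((U * (1 - Sᴴ * M)) *ᵥ w) ^ 2 / r ^ 2 ≤ eucNorm w ^ 2 := by
    rw [div_le_iff₀ (by positivity), mul_comm, ← mul_pow]
    exact pow_le_pow_left₀ (eucNorm_nonneg _) h2 2
  have h3 : (1 - c ^ 2) / r ^ 2 * eucNorm ((U * (1 - Sᴴ * M)) *ᵥ w) ^ 2 ≤
      (1 - c ^ 2) * eucNorm w ^ 2 := by
    rw [div_mul_eq_mul_div, mul_div_assoc]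
    exact mul_le_mul_of_nonneg_left h2' (by nlinarith)
  nlinarith

/-- Uniform contractivity passes from the loop-shifted transform of `M` back to `M`. -/
theorem exists_bound_of_shifted (h : LoopShift S U Q) {c : ℝ} (hc : 0 ≤ c) (hc1 : c < 1) :
    ∃ d, 0 ≤ d ∧ d < 1 ∧ ∀ M T : Matrix ι κ ℂ, T * (U * (1 - Sᴴ * M)) = Q * (M - S) →
      ‖T‖ ≤ c → ‖M‖ ≤ d := by
  have hU : (1 - Sᴴ * S) * Uᴴ * U = 1 := by
    rw [Matrix.mul_assoc]
    exact mul_eq_one_comm.1 h.left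
  have hQ : (1 - S * Sᴴ) * Qᴴ * Q = 1 := by
    rw [Matrix.mul_assoc]
    exact mul_eq_one_comm.1 h.right
  -- Here u need not determine w by itself, since M is not yet known to be contractive. But (1 -
  -- S†M) + S†(M - S) = 1 - S†S, so w is a fixed linear function of u and Tu, and |w| ≤ r|u| with r
  -- independent of M.
  set P₁ := (Uᴴ * U) * ((1 - Sᴴ * S) * Uᴴ)
  set P₂ := (Uᴴ * U) * (Sᴴ * ((1 - S * Sᴴ) * Qᴴ))
  have hid : ∀ M : Matrix ι κ ℂ, P₁ * (U * (1 - Sᴴ * M)) + P₂ * (Q * (M - S)) = 1 := by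
    intro M
    calc P₁ * (U * (1 - Sᴴ * M)) + P₂ * (Q * (M - S))
        = (Uᴴ * U) * (((1 - Sᴴ * S) * Uᴴ * U) * (1 - Sᴴ * M)
            + Sᴴ * (((1 - S * Sᴴ) * Qᴴ * Q) * (M - S))) := by
          simp only [P₁, P₂, Matrix.mul_assoc, Matrix.mul_add]
      _ = (Uᴴ * U) * (1 - Sᴴ * S) := by
          rw [hU, hQ, Matrix.one_mul, Matrix.one_mul, Matrix.mul_sub Sᴴ]
          congr 1
          abel
      _ = 1 := h.left
  set r := ‖P₁‖ + ‖P₂‖ + 1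
  have hr : 1 ≤ r := le_add_of_nonneg_left (by positivity)
  have hq : 0 < (1 - c ^ 2) / r ^ 2 := div_pos (by nlinarith) (by positivity)
  have hq1 : (1 - c ^ 2) / r ^ 2 ≤ 1 := by
    rw [div_le_one (by positivity)]
    nlinarith
  refine ⟨Real.sqrt (1 - (1 - c ^ 2) / r ^ 2), Real.sqrt_nonneg _, ?_, fun M T hT hTc => ?_⟩
  · rw [Real.sqrt_lt' one_pos]
    linarith
  refine norm_le_of_eucNorm_mulVec_le (Real.sqrt_nonneg _) fun w => ?_
  have e := h.energy_mulVec M w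
  set u := (U * (1 - Sᴴ * M)) *ᵥ w with hu
  have hy : (Q * (M - S)) *ᵥ w = T *ᵥ u := by rw [← hT, hu, mulVec_mulVec]
  have h1 : eucNorm (T *ᵥ u) ≤ c * eucNorm u := (eucNorm_mulVec_le T u).trans
    (mul_le_mul_of_nonneg_right hTc (eucNorm_nonneg u))
  have hw : w = P₁ *ᵥ u + P₂ *ᵥ (T *ᵥ u) := by
    rw [← hy, hu, mulVec_mulVec, mulVec_mulVec, ← add_mulVec, hid, one_mulVec]
  have h2 : eucNorm w ≤ r * eucNorm u := by
    have a1 := eucNorm_mulVec_le P₁ u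
    have a2 := eucNorm_mulVec_le P₂ (T *ᵥ u)
    have a3 := eucNorm_add_le (P₁ *ᵥ u) (P₂ *ᵥ (T *ᵥ u))
    rw [← hw] at a3
    have a4 : ‖P₂‖ * eucNorm (T *ᵥ u) ≤ ‖P₂‖ * eucNorm u :=
      mul_le_mul_of_nonneg_left (h1.trans (mul_le_of_le_one_left (eucNorm_nonneg u) hc1.le))
        (norm_nonneg _)
    have a5 := eucNorm_nonneg u
    simp only [r]
    nlinarith
  rw [hy] at e
  refine (pow_le_pow_iff_left₀ (eucNorm_nonneg _)
    (mul_nonneg (Real.sqrt_nonneg _) (eucNorm_nonneg _)) two_ne_zero).1 ?_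
  rw [mul_pow, Real.sq_sqrt (by linarith)]
  have h1' : eucNorm (T *ᵥ u) ^ 2 ≤ c ^ 2 * eucNorm u ^ 2 := by
    rw [← mul_pow]
    exact pow_le_pow_left₀ (eucNorm_nonneg _) h1 2
  have h2' : eucNorm w ^ 2 / r ^ 2 ≤ eucNorm u ^ 2 := by
    rw [div_le_iff₀ (by positivity), mul_comm, ← mul_pow]
    exact pow_le_pow_left₀ (eucNorm_nonneg _) h2 2
  have h3 : (1 - c ^ 2) / r ^ 2 * eucNorm w ^ 2 ≤ (1 - c ^ 2) * eucNorm u ^ 2 := by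
    rw [div_mul_eq_mul_div, mul_div_assoc]
    exact mul_le_mul_of_nonneg_left h2' (by nlinarith)
  nlinarith

end LoopShift

end Energy

/-! ### State-space realizations: hidden modes, well-posedness, closed-loop spectrum. -/

section Realization

variable {m k a b : ℕ} {s : ℂ}

theorem transfer_eq (A : Matrix (Fin k) (Fin k) ℂ) (B : Matrix (Fin k) (Fin b) ℂ)
    (C : Matrix (Fin a) (Fin k) ℂ) (D : Matrix (Fin a) (Fin b) ℂ) :
    transfer A B C D = matConst C * (pencil A)⁻¹ * matConst B + matConst D := rfl

theorem matRegular_pencil_inv {ι : Type*} [Fintype ι] [DecidableEq ι] {A : Matrix ι ι ℂ}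
    (h : IsUnit (s • 1 - A)) : MatRegular s (pencil A)⁻¹ :=
  ((matRegular_pencil A).exists_inverse (by rwa [matEval_pencil])).2

theorem matEval_pencil_inv_mul {ι : Type*} [Fintype ι] [DecidableEq ι] {A : Matrix ι ι ℂ}
    (h : MatRegular s (pencil A)⁻¹) : matEval s (pencil A)⁻¹ * (s • 1 - A) = 1 := by
  rw [← matEval_pencil, ← matEval_mul h (matRegular_pencil A),
    Matrix.nonsing_inv_mul _ (isUnit_det_pencil A), matEval_one]

theorem matEval_pencil_inv {ι : Type*} [Fintype ι] [DecidableEq ι] {A : Matrix ι ι ℂ}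
    (h : IsUnit (s • 1 - A)) : matEval s (pencil A)⁻¹ = (s • 1 - A)⁻¹ :=
  (Matrix.inv_eq_left_inv (matEval_pencil_inv_mul (matRegular_pencil_inv h))).symm

theorem pencil_fromBlocks {ι κ : Type*} [DecidableEq ι] [DecidableEq κ] (A : Matrix ι ι ℂ)
    (B : Matrix ι κ ℂ) (C : Matrix κ ι ℂ) (D : Matrix κ κ ℂ) :
    pencil (fromBlocks A B C D) =
      fromBlocks (pencil A) (-matConst B) (-matConst C) (pencil D) := by
  rw [pencil, pencil, pencil, matConst, fromBlocks_map, ← fromBlocks_one, fromBlocks_smul,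
    sub_eq_add_neg, fromBlocks_neg, fromBlocks_add]
  simp [matConst, sub_eq_add_neg]

/-- Hidden modes of a realization are visible in the closed loop: if the feedback interconnection
is Hurwitz and the transfer function belongs to `H_∞`, then the realization is Hurwitz. -/
theorem hurwitz_of_hurwitz_fromBlocks {A : Matrix (Fin m) (Fin m) ℂ} {B : Matrix (Fin m) (Fin a) ℂ}
    {C : Matrix (Fin b) (Fin m) ℂ} {α : Matrix (Fin k) (Fin k) ℂ} {β : Matrix (Fin k) (Fin b) ℂ}
    {c : Matrix (Fin a) (Fin k) ℂ} {d : Matrix (Fin a) (Fin b) ℂ}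
    (h : Hurwitz (fromBlocks A (B * c) (β * C) α)) (hK : InHInf (transfer α β c d)) :
    Hurwitz α := by
  rw [hurwitz_iff] at h ⊢
  intro s hs
  set Φ := (pencil α)⁻¹
  have hΦl : Φ * pencil α = 1 := Matrix.nonsing_inv_mul _ (isUnit_det_pencil α)
  have hΦr : pencil α * Φ = 1 := Matrix.mul_nonsing_inv _ (isUnit_det_pencil α)
  obtain ⟨N, hN⟩ : ∃ N, N = (pencil (fromBlocks A (B * c) (β * C) α))⁻¹ := ⟨_, rfl⟩
  have hreg : MatRegular s N := hN ▸ matRegular_pencil_inv (h s hs)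
  have hr : pencil (fromBlocks A (B * c) (β * C) α) * N = 1 := by
    rw [hN, Matrix.mul_nonsing_inv _ (isUnit_det_pencil _)]
  have hl : N * pencil (fromBlocks A (B * c) (β * C) α) = 1 := by
    rw [hN, Matrix.nonsing_inv_mul _ (isUnit_det_pencil _)]
  have hreg12 : MatRegular s N.toBlocks₁₂ :=
    matRegular_iff.2 fun i j => matRegular_iff.1 hreg (Sum.inl i) (Sum.inr j)
  have hreg21 : MatRegular s N.toBlocks₂₁ :=
    matRegular_iff.2 fun i j => matRegular_iff.1 hreg (Sum.inr i) (Sum.inl j)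
  have hreg22 : MatRegular s N.toBlocks₂₂ :=
    matRegular_iff.2 fun i j => matRegular_iff.1 hreg (Sum.inr i) (Sum.inr j)
  rw [← fromBlocks_toBlocks N, pencil_fromBlocks, fromBlocks_multiply, ← fromBlocks_one,
    fromBlocks_inj] at hr hl
  have hr' := hr.2.2.2
  have hl' := hl.2.2.2
  set N12 := N.toBlocks₁₂
  set N21 := N.toBlocks₂₁
  set N22 := N.toBlocks₂₂
  -- The two one-sided inverse equations for the closed-loop pencil express Φ = (sI - α)⁻¹ through
  -- regular blocks. In `e1` the factor Φβ remains and in `e2` the factor cΦ.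
  have e1 : Φ = N22 - Φ * matConst β * matConst C * N12 := by
    have h : Φ * (-matConst (β * C) * N12 + pencil α * N22) = Φ := by rw [hr', Matrix.mul_one]
    rw [Matrix.mul_add, ← Matrix.mul_assoc Φ (pencil α), hΦl, Matrix.one_mul] at h
    refine h.symm.trans ?_
    simp only [matConst_mul, Matrix.neg_mul, Matrix.mul_neg, Matrix.mul_assoc]
    abel
  have e2 : Φ = N22 - N21 * matConst B * (matConst c * Φ) := by
    have h : (N21 * -matConst (B * c) + N22 * pencil α) * Φ = Φ := by rw [hl', Matrix.one_mul]
    rw [Matrix.add_mul, Matrix.mul_assoc N22, hΦr, Matrix.mul_one] at h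
    refine h.symm.trans ?_
    simp only [matConst_mul, Matrix.neg_mul, Matrix.mul_neg, Matrix.mul_assoc]
    abel
  have hcb : matConst c * Φ * matConst β = transfer α β c d - matConst d := by
    rw [transfer_eq, add_sub_cancel_right]
  -- Multiplying `e1` by c leaves only cΦβ, which is the transfer function minus d and thus regular.
  -- Then cΦ is regular, and `e2` gives Φ.
  have hcΦ : MatRegular s (matConst c * Φ) := by
    have : matConst c * Φ = matConst c * N22 - (transfer α β c d - matConst d) * matConst C * N12 := by
      rw [← hcb]
      nth_rewrite 1 [e1]
      simp only [Matrix.mul_sub, Matrix.mul_assoc]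
    rw [this]
    exact ((matRegular_const _).mul hreg22).sub
      ((((hK.matRegular hs).sub (matRegular_const _)).mul (matRegular_const _)).mul hreg12)
  have hΦ : MatRegular s Φ := by
    rw [e2]
    exact hreg22.sub ((hreg21.mul (matRegular_const _)).mul hcΦ)
  exact IsUnit.of_mul_eq_one_right _ (matEval_pencil_inv_mul hΦ)

/-- Feedback around a strictly proper block with a controller that has a state-space
realization is well posed. -/
theorem isUnit_det_one_sub_mul_transfer (A : Matrix (Fin m) (Fin m) ℂ) (B : Matrix (Fin m) (Fin a) ℂ)
    (C : Matrix (Fin b) (Fin m) ℂ) (α : Matrix (Fin k) (Fin k) ℂ) (β : Matrix (Fin k) (Fin b) ℂ)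
    (c : Matrix (Fin a) (Fin k) ℂ) (d : Matrix (Fin a) (Fin b) ℂ) :
    IsUnit (1 - transfer A B C 0 * transfer α β c d).det := by
  set K := transfer α β c d with hK
  have h1 := isUnit_det_pencil (fromBlocks (A + B * d * C) (B * c) (β * C) α)
  rw [pencil_fromBlocks] at h1
  let : Invertible (pencil α) := (pencil α).invertibleOfIsUnitDet (isUnit_det_pencil α)
  rw [det_fromBlocks₂₂, IsUnit.mul_iff, Matrix.invOf_eq_nonsing_inv] at h1
  -- The Schur complement of the controller block. Its determinant is nonzero because every pencil
  -- is invertible over the rational functions; stability plays no role.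
  have e : pencil (A + B * d * C) - -matConst (B * c) * (pencil α)⁻¹ * -matConst (β * C) =
      pencil A * (1 - (pencil A)⁻¹ * matConst B * (K * matConst C)) := by
    rw [Matrix.mul_sub, Matrix.mul_assoc (pencil A)⁻¹, ← Matrix.mul_assoc (pencil A),
      Matrix.mul_nonsing_inv _ (isUnit_det_pencil A), hK, transfer_eq]
    simp only [pencil, matConst_add, matConst_mul, Matrix.mul_add, Matrix.add_mul, Matrix.mul_assoc,
      Matrix.one_mul, Matrix.mul_one, Matrix.neg_mul, Matrix.mul_neg]
    abel
  have h2 := h1.2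
  rw [e, det_mul, IsUnit.mul_iff, ← Matrix.mul_assoc, det_one_sub_mul_comm] at h2
  rw [transfer_eq, matConst_zero, add_zero]
  simpa only [Matrix.mul_assoc] using h2.2

/-- The closed-loop matrix has no eigenvalue at `s` if the loop closed by the value of the
controller at `s` has none. -/
theorem isUnit_sub_fromBlocks {A : Matrix (Fin m) (Fin m) ℂ} {B : Matrix (Fin m) (Fin a) ℂ}
    {C : Matrix (Fin b) (Fin m) ℂ} {α : Matrix (Fin k) (Fin k) ℂ} {β : Matrix (Fin k) (Fin b) ℂ}
    {c : Matrix (Fin a) (Fin k) ℂ} {d : Matrix (Fin a) (Fin b) ℂ} (hα : IsUnit (s • 1 - α))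
    (h : ∀ v, (s • 1 - A) *ᵥ v = (B * matEval s (transfer α β c d) * C) *ᵥ v → v = 0) :
    IsUnit (s • 1 - fromBlocks (A + B * d * C) (B * c) (β * C) α) := by
  have hK : matEval s (transfer α β c d) = c * (s • 1 - α)⁻¹ * β + d := by
    have hΦ := matRegular_pencil_inv hα
    rw [transfer_eq, matEval_add (((matRegular_const _).mul hΦ).mul (matRegular_const _))
      (matRegular_const _), matEval_mul ((matRegular_const _).mul hΦ) (matRegular_const _),
      matEval_mul (matRegular_const _) hΦ, matEval_pencil_inv hα]
    simp only [matEval_const]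
  have hinv : (s • 1 - α)⁻¹ * (s • 1 - α) = 1 :=
    Matrix.nonsing_inv_mul _ ((Matrix.isUnit_iff_isUnit_det _).1 hα)
  rw [Matrix.isUnit_iff_isUnit_det, isUnit_iff_ne_zero]
  intro h0
  obtain ⟨v, hv, hv'⟩ := exists_mulVec_eq_zero_iff.2 h0
  apply hv
  rw [sub_mulVec, ← fromBlocks_one, fromBlocks_smul, fromBlocks_mulVec, fromBlocks_mulVec,
    sub_eq_zero, Sum.elim_eq_iff] at hv'
  simp only [smul_zero, zero_mulVec, add_zero, zero_add] at hv'
  obtain ⟨e1, e2⟩ := hv'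
  set x := v ∘ Sum.inl
  set y := v ∘ Sum.inr
  -- Eliminating the controller state turns the controller into its value at `s`.
  have hy : y = ((s • 1 - α)⁻¹ * β * C) *ᵥ x := by
    have : (s • 1 - α) *ᵥ y = (β * C) *ᵥ x := by
      rw [sub_mulVec, e2, add_sub_cancel_right]
    rw [Matrix.mul_assoc, ← mulVec_mulVec, ← this, mulVec_mulVec, hinv, one_mulVec]
  have hx : x = 0 := by
    apply h
    rw [sub_mulVec, e1, hy, hK, mulVec_mulVec, add_mulVec, Matrix.mul_add, Matrix.add_mul,
      add_mulVec]
    simp only [Matrix.mul_assoc]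
    abel
  rw [hx, mulVec_zero] at hy
  ext (i | i)
  · exact congrFun hx i
  · exact congrFun hy i

theorem isUnit_sub_fromBlocks_zero₂₁ {ι κ : Type*} [Fintype ι] [Fintype κ] [DecidableEq ι]
    [DecidableEq κ] {A : Matrix ι ι ℂ} {B : Matrix ι κ ℂ} {D : Matrix κ κ ℂ} :
    IsUnit (s • 1 - fromBlocks A B 0 D) ↔ IsUnit (s • 1 - A) ∧ IsUnit (s • 1 - D) := by
  rw [← fromBlocks_one, fromBlocks_smul, sub_eq_add_neg, fromBlocks_neg, fromBlocks_add,
    smul_zero, smul_zero, neg_zero, add_zero, Matrix.isUnit_iff_isUnit_det, det_fromBlocks_zero₂₁,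
    IsUnit.mul_iff, ← sub_eq_add_neg, ← sub_eq_add_neg, ← Matrix.isUnit_iff_isUnit_det,
    ← Matrix.isUnit_iff_isUnit_det]

theorem hurwitz_fromBlocks_zero₂₁ {A : Matrix (Fin m) (Fin m) ℂ} {B : Matrix (Fin m) (Fin k) ℂ}
    {D : Matrix (Fin k) (Fin k) ℂ} :
    Hurwitz (fromBlocks A B 0 D) ↔ Hurwitz A ∧ Hurwitz D := by
  simp only [hurwitz_iff, isUnit_sub_fromBlocks_zero₂₁]
  exact ⟨fun h => ⟨fun s hs => (h s hs).1, fun s hs => (h s hs).2⟩,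
    fun h s hs => ⟨h.1 s hs, h.2 s hs⟩⟩

/-- Composition of a realization with constant matrices and an additive constant. -/
theorem const_mul_transfer_mul_const_add {a' b' : ℕ} (A : Matrix (Fin k) (Fin k) ℂ)
    (B : Matrix (Fin k) (Fin b) ℂ) (C : Matrix (Fin a) (Fin k) ℂ) (D : Matrix (Fin a) (Fin b) ℂ)
    (L : Matrix (Fin a') (Fin a) ℂ) (R : Matrix (Fin b) (Fin b') ℂ)
    (E : Matrix (Fin a') (Fin b') ℂ) :
    const L * transfer A B C D * const R + const E =
      transfer A (B * R) (L * C) (L * D * R + E) := by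
  change matConst L * transfer A B C D * matConst R + matConst E = _
  simp only [transfer_eq, matConst_mul, matConst_add, Matrix.mul_add, Matrix.add_mul,
    Matrix.mul_assoc, add_assoc]

end Realization

/-! ### Linear fractional transformations of the two kinds of plant. -/

namespace Plant

variable {m nw nv nz nx : ℕ} {P : Plant m nw nv nz nx}

theorem closedLoop_of_D₂₂_eq_zero {k : ℕ} (h : P.D₂₂ = 0) (a : Matrix (Fin k) (Fin k) ℂ)
    (b : Matrix (Fin k) (Fin nx) ℂ) (c : Matrix (Fin nv) (Fin k) ℂ)
    (d : Matrix (Fin nv) (Fin nx) ℂ) :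
    P.closedLoop a b c d =
      fromBlocks (P.A + P.B₂ * d * P.C₂) (P.B₂ * c) (b * P.C₂) a := by
  simp [closedLoop, h]

end Plant

theorem matConst_smul {ι κ : Type*} (g : ℂ) (M : Matrix ι κ ℂ) :
    matConst (g • M) = RatFunc.C g • matConst M := by
  ext i j
  simp [matConst]

namespace Plant

variable {m n nv nz : ℕ}

/-- The controller sees the disturbance unchanged, so no inverse survives and the closed loop is
affine in `H`. -/
theorem lft_of_C₂_eq_zero {P : Plant m n nv nz n} (hC : P.C₂ = 0) (hD₂₁ : P.D₂₁ = 1)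
    (hD₂₂ : P.D₂₂ = 0) (H : TFMat nv n) :
    P.lft H = matConst P.C₁ * (pencil P.A)⁻¹ * (matConst P.B₁ + matConst P.B₂ * H)
      + (matConst P.D₁₁ + matConst P.D₁₂ * H) := by
  simp only [lft, transfer_eq, hC, hD₂₁, hD₂₂, matConst_zero, matConst_one, Matrix.zero_mul,
    zero_add, sub_zero, inv_one, Matrix.mul_one, Matrix.mul_add, Matrix.add_mul, Matrix.mul_assoc]
  abel

/-- The response of the closed loop to a signal `u` for which a plant state `x` and a plant output
`w` are known. -/
theorem lft_mul {l : ℕ} {P : Plant m n nv nz n} (hD₁₁ : P.D₁₁ = 0) (hD₂₁ : P.D₂₁ = 1)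
    {K : TFMat nv n} (hu : IsUnit (1 - transfer P.A P.B₂ P.C₂ P.D₂₂ * K).det)
    (hD₂₂ : P.D₂₂ = 0) {x : TFMat m l} {u w : TFMat n l}
    (hw : w = matConst P.C₂ * x + u)
    (hx : pencil P.A * x = matConst P.B₁ * u + matConst P.B₂ * (K * w)) :
    P.lft K * u = matConst P.C₁ * x + matConst P.D₁₂ * (K * w) := by
  have hx' : x = (pencil P.A)⁻¹ * (matConst P.B₁ * u + matConst P.B₂ * (K * w)) := by
    rw [← hx, ← Matrix.mul_assoc, Matrix.nonsing_inv_mul _ (isUnit_det_pencil _), Matrix.one_mul]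
  have h1 : transfer P.A P.B₁ P.C₂ P.D₂₁ * u =
      (1 - transfer P.A P.B₂ P.C₂ P.D₂₂ * K) * w := by
    rw [Matrix.sub_mul, Matrix.one_mul]
    nth_rewrite 1 [hw]
    rw [hx']
    simp only [transfer_eq, hD₂₁, hD₂₂, matConst_zero, matConst_one, add_zero, Matrix.add_mul,
      Matrix.mul_add, Matrix.mul_assoc, Matrix.one_mul]
    abel
  have h2 : (1 - transfer P.A P.B₂ P.C₂ P.D₂₂ * K)⁻¹ * (transfer P.A P.B₁ P.C₂ P.D₂₁ * u) = w := by
    rw [h1, ← Matrix.mul_assoc, Matrix.nonsing_inv_mul _ hu, Matrix.one_mul]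
  rw [lft, Matrix.add_mul, Matrix.mul_assoc _ (transfer P.A P.B₁ P.C₂ P.D₂₁), Matrix.mul_assoc _ _⁻¹,
    h2, hx']
  simp only [transfer_eq, hD₁₁, matConst_zero, add_zero, Matrix.add_mul,
      Matrix.mul_add, Matrix.mul_assoc]
  abel

end Plant

/-! ### The abstract loop shift between two plants. -/

/-- The plant `P'` arises from the plant `P` by the loop shift with the strict contraction `S`:
a completion of the square in the output `ζ = g Ω z` followed by the change of the controller
`H = V K W† - J`. -/
structure PlantShift {m n nv nz : ℕ} (P P' : Plant m n nv nz n) (g : ℝ)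
    (Ω : Matrix (Fin nz) (Fin nz) ℂ) (S : Matrix (Fin nz) (Fin n) ℂ)
    (U : Matrix (Fin n) (Fin n) ℂ) (Q : Matrix (Fin nz) (Fin nz) ℂ)
    (V : Matrix (Fin nv) (Fin nv) ℂ) (W : Matrix (Fin n) (Fin n) ℂ)
    (J : Matrix (Fin nv) (Fin n) ℂ) : Prop where
  C₂_eq_zero : P.C₂ = 0
  D₂₁_eq_one : P.D₂₁ = 1
  D₂₂_eq_zero : P.D₂₂ = 0
  D₁₁_eq_zero' : P'.D₁₁ = 0
  D₂₁_eq_one' : P'.D₂₁ = 1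
  D₂₂_eq_zero' : P'.D₂₂ = 0
  g_pos : 0 < g
  Ω_mem : Ω ∈ Matrix.unitaryGroup (Fin nz) ℂ
  loopShift : LoopShift S U Q
  isUnit_V : IsUnit V
  isUnit_W : IsUnit W
  U_mul : U * (1 - Sᴴ * S) = Wᴴ
  S_mul : Sᴴ * P'.D₁₂ = 0
  Q_mul : Q * P'.D₁₂ = P'.D₁₂
  A_eq : P'.A = P.A + P'.B₁ * P'.C₂
  B₁_eq : P.B₁ - P.B₂ * J = (g : ℂ) • (P'.B₁ * Wᴴ)
  B₂_eq : P.B₂ * V = (g : ℂ) • P'.B₂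
  C₁_eq : P'.C₁ = Q * (Ωᴴ * P.C₁)
  C₂_eq : P'.C₂ = U * (Sᴴ * (Ωᴴ * P.C₁))
  D₁₁_eq : P.D₁₁ - P.D₁₂ * J = (g : ℂ) • (Ω * S)
  D₁₂_eq : P.D₁₂ * V = (g : ℂ) • (Ω * P'.D₁₂)

namespace PlantShift

open scoped Matrix.Norms.L2Operator

variable {m n nv nz : ℕ} {P P' : Plant m n nv nz n} {g : ℝ}
    {Ω : Matrix (Fin nz) (Fin nz) ℂ} {S : Matrix (Fin nz) (Fin n) ℂ}
    {U : Matrix (Fin n) (Fin n) ℂ} {Q : Matrix (Fin nz) (Fin nz) ℂ}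
    {V : Matrix (Fin nv) (Fin nv) ℂ} {W : Matrix (Fin n) (Fin n) ℂ}
    {J : Matrix (Fin nv) (Fin n) ℂ}

/-- The state response of the plant, scaled by `g⁻¹`. -/
def stateResponse (P P' : Plant m n nv nz n) (W : Matrix (Fin n) (Fin n) ℂ) (K : TFMat nv n) :
    TFMat m n :=
  (pencil P.A)⁻¹ * ((matConst P'.B₁ + matConst P'.B₂ * K) * matConst Wᴴ)

/-- The closed-loop transfer function of the plant, normalized to the level one. -/
def normalized (P P' : Plant m n nv nz n) (Ω : Matrix (Fin nz) (Fin nz) ℂ)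
    (S : Matrix (Fin nz) (Fin n) ℂ) (W : Matrix (Fin n) (Fin n) ℂ) (K : TFMat nv n) : TFMat nz n :=
  matConst S + matConst P'.D₁₂ * (K * matConst Wᴴ) +
    matConst (Ωᴴ * P.C₁) * stateResponse P P' W K

theorem pencil_mul_stateResponse (K : TFMat nv n) :
    pencil P.A * stateResponse P P' W K =
      (matConst P'.B₁ + matConst P'.B₂ * K) * matConst Wᴴ := by
  rw [stateResponse, ← Matrix.mul_assoc, Matrix.mul_nonsing_inv _ (isUnit_det_pencil _),
    Matrix.one_mul]

theorem stateResponse_matRegular {K : TFMat nv n} {s : ℂ} (hA : IsUnit (s • 1 - P.A))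
    (hK : MatRegular s K) : MatRegular s (stateResponse P P' W K) :=
  (matRegular_pencil_inv hA).mul
    (((matRegular_const _).add ((matRegular_const _).mul hK)).mul (matRegular_const _))

theorem normalized_matRegular {K : TFMat nv n} {s : ℂ} (hA : IsUnit (s • 1 - P.A))
    (hK : MatRegular s K) : MatRegular s (normalized P P' Ω S W K) :=
  ((matRegular_const _).add ((matRegular_const _).mul (hK.mul (matRegular_const _)))).add
    ((matRegular_const _).mul (stateResponse_matRegular hA hK))

theorem matEval_U_mul {N : TFMat nz n} {s : ℂ}
    (hM : MatRegular s N) :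
    MatRegular s (matConst U * (1 - matConst Sᴴ * N)) ∧
    matEval s (matConst U * (1 - matConst Sᴴ * N)) =
      U * (1 - Sᴴ * matEval s N) := by
  have h1 := (matRegular_const (s := s) Sᴴ).mul hM
  have h2 : MatRegular s (1 - matConst Sᴴ * N) := matRegular_one.sub h1
  refine ⟨(matRegular_const U).mul h2, ?_⟩
  rw [matEval_mul (matRegular_const U) h2, matEval_sub matRegular_one h1, matEval_one,
    matEval_mul (matRegular_const _) hM, matEval_const, matEval_const]

section
variable (h : PlantShift P P' g Ω S U Q V W J)
include h

theorem lft_eq (K : TFMat nv n) :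
    P.lft (const V * K * const Wᴴ - const J) =
      matConst ((g : ℂ) • Ω) * normalized P P' Ω S W K := by
  have hΩ : Ω * Ωᴴ = 1 := Matrix.mem_unitaryGroup_iff.1 h.Ω_mem
  have hB : matConst P.B₁ + matConst P.B₂ * (const V * K * const Wᴴ - const J) =
      RatFunc.C (g : ℂ) • ((matConst P'.B₁ + matConst P'.B₂ * K) * matConst Wᴴ) := by
    calc _ = matConst (P.B₁ - P.B₂ * J) + matConst (P.B₂ * V) * (K * matConst Wᴴ) := by
          change matConst P.B₁ + matConst P.B₂ * (matConst V * K * matConst Wᴴ - matConst J) = _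
          simp only [matConst_sub, matConst_mul, Matrix.mul_sub, Matrix.mul_assoc]
          abel
      _ = _ := by
          rw [h.B₁_eq, h.B₂_eq]
          simp only [matConst_smul, matConst_mul, Matrix.add_mul, Matrix.smul_mul, smul_add,
            Matrix.mul_assoc]
  have hD : matConst P.D₁₁ + matConst P.D₁₂ * (const V * K * const Wᴴ - const J) =
      RatFunc.C (g : ℂ) • (matConst Ω * (matConst S + matConst P'.D₁₂ * (K * matConst Wᴴ))) := by
    calc _ = matConst (P.D₁₁ - P.D₁₂ * J) + matConst (P.D₁₂ * V) * (K * matConst Wᴴ) := by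
          change matConst P.D₁₁ + matConst P.D₁₂ * (matConst V * K * matConst Wᴴ - matConst J) = _
          simp only [matConst_sub, matConst_mul, Matrix.mul_sub, Matrix.mul_assoc]
          abel
      _ = _ := by
          rw [h.D₁₁_eq, h.D₁₂_eq]
          simp only [matConst_smul, matConst_mul, Matrix.mul_add, Matrix.smul_mul, smul_add,
            Matrix.mul_assoc]
  have hC : matConst P.C₁ = matConst Ω * matConst (Ωᴴ * P.C₁) := by
    rw [← matConst_mul, ← Matrix.mul_assoc, hΩ, Matrix.one_mul]
  rw [Plant.lft_of_C₂_eq_zero h.C₂_eq_zero h.D₂₁_eq_one h.D₂₂_eq_zero, hB, hD, hC, normalized,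
    stateResponse, matConst_smul]
  simp only [Matrix.mul_add, Matrix.smul_mul, Matrix.mul_smul, smul_add, Matrix.mul_assoc]
  abel

/-- The direct term of K disappears because `Sᴴ * P'.D₁₂ = 0`. The right side is the exogenous input
of `P'` for which the measured output is `Wᴴ` along the common state response. -/
theorem U_mul_one_sub (K : TFMat nv n) :
    matConst U * (1 - matConst Sᴴ * normalized P P' Ω S W K) =
      matConst Wᴴ - matConst P'.C₂ * stateResponse P P' W K := by
  have h0 : matConst Sᴴ * (matConst P'.D₁₂ * (K * matConst Wᴴ)) = 0 := by
    rw [← Matrix.mul_assoc, ← matConst_mul, h.S_mul, matConst_zero, Matrix.zero_mul]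
  rw [← h.U_mul, h.C₂_eq, normalized, Matrix.mul_add (matConst Sᴴ), Matrix.mul_add (matConst Sᴴ),
    h0, add_zero]
  simp only [matConst_mul, matConst_sub, matConst_one, Matrix.mul_sub, Matrix.mul_add,
    Matrix.mul_assoc]
  abel

/-- By `A_eq`, the state response of `P` also solves the state equation of `P'` with input `U (1 -
Sᴴ M)`; the resulting output is `Q (M - S)`. -/
theorem lft_shifted_mul {K : TFMat nv n}
    (hu : IsUnit (1 - transfer P'.A P'.B₂ P'.C₂ P'.D₂₂ * K).det) :
    P'.lft K * (matConst U * (1 - matConst Sᴴ * normalized P P' Ω S W K)) =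
      matConst Q * (normalized P P' Ω S W K - matConst S) := by
  have hx : pencil P'.A * stateResponse P P' W K =
      matConst P'.B₁ * (matConst Wᴴ - matConst P'.C₂ * stateResponse P P' W K) +
        matConst P'.B₂ * (K * matConst Wᴴ) := by
    have e : pencil P'.A = pencil P.A - matConst P'.B₁ * matConst P'.C₂ := by
      rw [pencil, pencil, h.A_eq, matConst_add, matConst_mul]
      abel
    rw [e, Matrix.sub_mul, pencil_mul_stateResponse]
    simp only [Matrix.mul_sub, Matrix.add_mul, Matrix.mul_assoc]
    abel
  rw [h.U_mul_one_sub, Plant.lft_mul h.D₁₁_eq_zero' h.D₂₁_eq_one' hu h.D₂₂_eq_zero'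
    (w := matConst Wᴴ) (by abel) hx, h.C₁_eq, normalized]
  nth_rewrite 1 [← h.Q_mul]
  simp only [matConst_mul, Matrix.mul_add, Matrix.mul_sub, Matrix.mul_assoc]
  abel

/-- A unitary factor does not change the norm. The bound is extended to the imaginary axis by
continuity, as the Hurwitz test needs it there too. -/
theorem hInfNorm_lft_lt_iff (hA : Hurwitz P.A) {K : TFMat nv n} (hK : InHInf K) :
    hInfNorm (P.lft (const V * K * const Wᴴ - const J)) < ENNReal.ofReal g ↔
      ∃ c, 0 ≤ c ∧ c < 1 ∧ ∀ s : ℂ, 0 ≤ s.re → ‖matEval s (normalized P P' Ω S W K)‖ ≤ c := by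
  have hreg : ∀ s : ℂ, 0 ≤ s.re → MatRegular s (normalized P P' Ω S W K) := fun s hs =>
    normalized_matRegular (hurwitz_iff.1 hA s hs) (hK.matRegular hs)
  have hn : ∀ s : ℂ, 0 ≤ s.re → ‖matEval s (P.lft (const V * K * const Wᴴ - const J))‖ =
      g * ‖matEval s (normalized P P' Ω S W K)‖ := by
    intro s hs
    rw [h.lft_eq, matEval_mul (matRegular_const _) (hreg s hs), matEval_const, Matrix.smul_mul,
      norm_smul, Complex.norm_real, Real.norm_of_nonneg h.g_pos.le]
    congr 1
    have hΩ : Ωᴴ * Ω = 1 := Matrix.mem_unitaryGroup_iff'.1 h.Ω_mem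
    rw [← sq_eq_sq₀ (norm_nonneg _) (norm_nonneg _), sq, sq, ← l2_opNorm_conjTranspose_mul_self,
      ← l2_opNorm_conjTranspose_mul_self, conjTranspose_mul, Matrix.mul_assoc, ← Matrix.mul_assoc Ωᴴ,
      hΩ, Matrix.one_mul]
  rw [hInfNorm_lt_iff h.g_pos]
  constructor
  · rintro ⟨c, hc, hcg, hb⟩
    refine ⟨c / g, div_nonneg hc h.g_pos.le, (div_lt_one h.g_pos).2 hcg, fun s hs =>
      norm_matEval_le Set.finite_empty (fun z hz _ => ?_) hs (hreg s hs)⟩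
    rw [le_div_iff₀ h.g_pos, mul_comm, ← hn z hz.le]
    exact hb z hz
  · rintro ⟨c, hc, hc1, hb⟩
    refine ⟨g * c, mul_nonneg h.g_pos.le hc, mul_lt_of_lt_one_right h.g_pos hc1, fun s hs => ?_⟩
    rw [hn s hs.le]
    exact mul_le_mul_of_nonneg_left (hb s hs.le) h.g_pos.le

theorem matEval_lft_shifted_mul {K : TFMat nv n} {s : ℂ}
    (hu : IsUnit (1 - transfer P'.A P'.B₂ P'.C₂ P'.D₂₂ * K).det)
    (hM : MatRegular s (normalized P P' Ω S W K)) (hT : MatRegular s (P'.lft K)) :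
    matEval s (P'.lft K) * (U * (1 - Sᴴ * matEval s (normalized P P' Ω S W K))) =
      Q * (matEval s (normalized P P' Ω S W K) - S) := by
  obtain ⟨h1, h2⟩ := matEval_U_mul (U := U) (S := S) hM
  rw [← h2, ← matEval_mul hT h1, h.lft_shifted_mul hu,
    matEval_mul (matRegular_const _) (hM.sub (matRegular_const _)),
    matEval_sub hM (matRegular_const _), matEval_const, matEval_const]

/-- Where M is contractive, `U (1 - Sᴴ M)` is invertible, so T = Q(M - S)(U(1 - S†M))⁻¹ has no pole.
-/
theorem matRegular_lft_shifted {K : TFMat nv n} {s : ℂ}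
    (hu : IsUnit (1 - transfer P'.A P'.B₂ P'.C₂ P'.D₂₂ * K).det)
    (hM : MatRegular s (normalized P P' Ω S W K))
    (hlt : ‖matEval s (normalized P P' Ω S W K)‖ < 1) : MatRegular s (P'.lft K) := by
  obtain ⟨h1, h2⟩ := matEval_U_mul (U := U) (S := S) hM
  obtain ⟨h3, h4⟩ := h1.exists_inverse (by rw [h2]; exact h.loopShift.isUnit_of_norm_lt_one hlt)
  have e : P'.lft K = matConst Q * (normalized P P' Ω S W K - matConst S) *
      (matConst U * (1 - matConst Sᴴ * normalized P P' Ω S W K))⁻¹ := by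
    rw [← h.lft_shifted_mul hu, Matrix.mul_assoc, Matrix.mul_nonsing_inv _ h3, Matrix.mul_one]
  rw [e]
  exact ((matRegular_const _).mul (hM.sub (matRegular_const _))).mul h4

/-- The loop shift preserves the strict norm bound. -/
theorem hInfNorm_lft_shifted_lt_iff (hA : Hurwitz P.A) {K : TFMat nv n} (hK : InHInf K)
    (hu : IsUnit (1 - transfer P'.A P'.B₂ P'.C₂ P'.D₂₂ * K).det) :
    hInfNorm (P'.lft K) < ENNReal.ofReal 1 ↔
      hInfNorm (P.lft (const V * K * const Wᴴ - const J)) < ENNReal.ofReal g := by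
  have hreg : ∀ s : ℂ, 0 ≤ s.re → MatRegular s (normalized P P' Ω S W K) := fun s hs =>
    normalized_matRegular (hurwitz_iff.1 hA s hs) (hK.matRegular hs)
  rw [h.hInfNorm_lft_lt_iff hA hK, hInfNorm_lt_iff one_pos]
  constructor
  · rintro ⟨c, hc, hc1, hb⟩
    obtain ⟨d, hd, hd1, H⟩ := h.loopShift.exists_bound_of_shifted hc hc1
    -- At a pole of T the evaluation returns the default value of a division by zero. The finitely
    -- many poles are therefore skipped and the bound for M is recovered by continuity.
    refine ⟨d, hd, hd1, fun s hs => norm_matEval_le (finite_setOf_not_matRegular (P'.lft K))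
      (fun z hz hzF => ?_) hs (hreg s hs)⟩
    have hT : MatRegular z (P'.lft K) := by
      by_contra hn
      exact hzF hn
    exact H _ _ (h.matEval_lft_shifted_mul hu (hreg z hz.le) hT) (hb z hz)
  · rintro ⟨c, hc, hc1, hb⟩
    obtain ⟨d, hd, hd1, H⟩ := h.loopShift.exists_bound_shifted hc hc1
    refine ⟨d, hd, hd1, fun s hs => ?_⟩
    have hM := hreg s hs.le
    exact H _ _ (h.matEval_lft_shifted_mul hu hM
      (h.matRegular_lft_shifted hu hM ((hb s hs.le).trans_lt hc1))) (hb s hs.le)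

theorem isUnit_det_one_sub {K : TFMat nv n} {k : ℕ} {a : Matrix (Fin k) (Fin k) ℂ}
    {b : Matrix (Fin k) (Fin n) ℂ} {c : Matrix (Fin nv) (Fin k) ℂ} {d : Matrix (Fin nv) (Fin n) ℂ}
    (hK : K = transfer a b c d) :
    IsUnit (1 - transfer P'.A P'.B₂ P'.C₂ P'.D₂₂ * K).det := by
  rw [hK, h.D₂₂_eq_zero']
  exact isUnit_det_one_sub_mul_transfer _ _ _ _ _ _ _

/-- With `P.C₂ = 0` the closed-loop matrix is block triangular, with diagonal blocks `P.A` and `a`.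
-/
theorem internallyStabilizedBy_iff (hA : Hurwitz P.A) {H : TFMat nv n} :
    P.InternallyStabilizedBy H ↔ ∃ (k : ℕ) (a : Matrix (Fin k) (Fin k) ℂ)
      (b : Matrix (Fin k) (Fin n) ℂ) (c : Matrix (Fin nv) (Fin k) ℂ) (d : Matrix (Fin nv) (Fin n) ℂ),
      H = transfer a b c d ∧ Hurwitz a := by
  simp only [Plant.InternallyStabilizedBy, Plant.closedLoop_of_D₂₂_eq_zero h.D₂₂_eq_zero,
    h.C₂_eq_zero, h.D₂₂_eq_zero, Matrix.mul_zero, Matrix.zero_mul, add_zero, sub_zero,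
    hurwitz_fromBlocks_zero₂₁, isUnit_one, true_and, hA]

/-- Small gain: a stable controller which makes the normalized closed loop contractive stabilizes
the shifted plant. -/
theorem hurwitz_closedLoop_shifted (hA : Hurwitz P.A) {k : ℕ} {a : Matrix (Fin k) (Fin k) ℂ}
    {b : Matrix (Fin k) (Fin n) ℂ} {c : Matrix (Fin nv) (Fin k) ℂ} {d : Matrix (Fin nv) (Fin n) ℂ}
    (ha : Hurwitz a) (hK : InHInf (transfer a b c d))
    (hlt : ∀ s : ℂ, 0 ≤ s.re → ‖matEval s (normalized P P' Ω S W (transfer a b c d))‖ < 1) :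
    Hurwitz (P'.closedLoop a b c d) := by
  rw [Plant.closedLoop_of_D₂₂_eq_zero h.D₂₂_eq_zero', hurwitz_iff]
  intro s hs
  refine isUnit_sub_fromBlocks (hurwitz_iff.1 ha s hs) fun v hv => ?_
  set K := transfer a b c d
  have hKs := hK.matRegular hs
  have hAs := hurwitz_iff.1 hA s hs
  have hx : MatRegular s (stateResponse P P' W K) := stateResponse_matRegular hAs hKs
  have hM : MatRegular s (normalized P P' Ω S W K) := normalized_matRegular hAs hKs
  have e1 : (s • 1 - P.A) * matEval s (stateResponse P P' W K) =
      (P'.B₁ + P'.B₂ * matEval s K) * Wᴴ := by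
    have h1 := (matRegular_const P'.B₂).mul hKs
    rw [← matEval_pencil, ← matEval_mul (matRegular_pencil _) hx, pencil_mul_stateResponse,
      matEval_mul ((matRegular_const _).add h1) (matRegular_const _),
      matEval_add (matRegular_const _) h1, matEval_mul (matRegular_const _) hKs]
    simp only [matEval_const]
  have e2 : U * (1 - Sᴴ * matEval s (normalized P P' Ω S W K)) =
      Wᴴ - P'.C₂ * matEval s (stateResponse P P' W K) := by
    rw [← (matEval_U_mul (U := U) (S := S) hM).2, h.U_mul_one_sub,
      matEval_sub (matRegular_const _) ((matRegular_const _).mul hx),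
      matEval_mul (matRegular_const _) hx, matEval_const, matEval_const]
  have hW : IsUnit Wᴴ := h.isUnit_W.star
  -- With `Wᴴ w = C₂' v`, the mode equation (s - A')v = B₂' K C₂' v becomes (s - A)v = (B₁' + B₂' K)
  -- Wᴴ w by `A_eq`. So v is the state response to w, and w lies in the kernel of `U (1 - Sᴴ M)`.
  obtain ⟨w, hw⟩ := (Matrix.mulVec_surjective_iff_isUnit.2 hW) (P'.C₂ *ᵥ v)
  have hvx : v = matEval s (stateResponse P P' W K) *ᵥ w := by
    apply Matrix.mulVec_injective_of_isUnit hAs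
    rw [mulVec_mulVec, e1, ← mulVec_mulVec, hw, ← sub_eq_zero]
    rw [h.A_eq, ← sub_eq_zero] at hv
    rw [← hv]
    simp only [sub_mulVec, add_mulVec, ← mulVec_mulVec]
    abel
  have hw0 : w = 0 := by
    apply h.loopShift.injective_of_norm_lt_one (hlt s hs)
    rw [e2, sub_mulVec, hw, ← mulVec_mulVec, ← hvx, sub_self]
  rw [hvx, hw0, mulVec_zero]

theorem inv_mul_mul_inv (K : TFMat nv n) :
    const V⁻¹ * (const V * K * const Wᴴ - const J) * const (Wᴴ)⁻¹ + const (V⁻¹ * J * (Wᴴ)⁻¹) = K := by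
  have hV : V⁻¹ * V = 1 := Matrix.nonsing_inv_mul _ ((Matrix.isUnit_iff_isUnit_det _).1 h.isUnit_V)
  have hW : Wᴴ * (Wᴴ)⁻¹ = 1 :=
    Matrix.mul_nonsing_inv _ ((Matrix.isUnit_iff_isUnit_det _).1 h.isUnit_W.star)
  change matConst V⁻¹ * (matConst V * K * matConst Wᴴ - matConst J) * matConst (Wᴴ)⁻¹ +
    matConst (V⁻¹ * J * (Wᴴ)⁻¹) = K
  calc _ = matConst (V⁻¹ * V) * K * matConst (Wᴴ * (Wᴴ)⁻¹) := by
        simp only [matConst_mul, Matrix.mul_sub, Matrix.sub_mul, Matrix.mul_assoc]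
        abel
    _ = K := by rw [hV, hW, matConst_one, matConst_one, Matrix.one_mul, Matrix.mul_one]

theorem mul_inv_mul_inv_mul (H : TFMat nv n) :
    const V * (const V⁻¹ * H * const (Wᴴ)⁻¹ + const (V⁻¹ * J * (Wᴴ)⁻¹)) * const Wᴴ - const J = H := by
  have hV : V * V⁻¹ = 1 := Matrix.mul_nonsing_inv _ ((Matrix.isUnit_iff_isUnit_det _).1 h.isUnit_V)
  have hW : (Wᴴ)⁻¹ * Wᴴ = 1 :=
    Matrix.nonsing_inv_mul _ ((Matrix.isUnit_iff_isUnit_det _).1 h.isUnit_W.star)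
  change matConst V * (matConst V⁻¹ * H * matConst (Wᴴ)⁻¹ + matConst (V⁻¹ * J * (Wᴴ)⁻¹)) *
    matConst Wᴴ - matConst J = H
  calc _ = matConst (V * V⁻¹) * H * matConst ((Wᴴ)⁻¹ * Wᴴ) +
          matConst (V * V⁻¹ * J * ((Wᴴ)⁻¹ * Wᴴ)) - matConst J := by
        simp only [matConst_mul, Matrix.mul_add, Matrix.add_mul, Matrix.mul_assoc]
    _ = H := by
        rw [hV, hW, matConst_one, matConst_one, Matrix.one_mul, Matrix.mul_one, Matrix.one_mul,
          Matrix.mul_one, add_sub_cancel_right]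

/-- The change of controller turns solutions of the two-disk problem for the shifted plant into
solutions of the contractive two-disk problem for the original plant, and conversely. -/
theorem solvesTwoDisk_iff (hA : Hurwitz P.A) (K : TFMat nv n) :
    P'.SolvesTwoDisk 1 V W J K ↔
      P.SolvesContractiveTwoDisk g (const V * K * const Wᴴ - const J) := by
  unfold Plant.SolvesTwoDisk Plant.SolvesContractiveTwoDisk
  constructor
  · rintro ⟨hK, ⟨k, a, b, c, d, rfl, -, hcl⟩, hT, hJ⟩
    refine ⟨((inHInf_const V).mul hK |>.mul (inHInf_const _)).sub (inHInf_const J), ?_,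
      (h.hInfNorm_lft_shifted_lt_iff hA hK (h.isUnit_det_one_sub rfl)).1 hT, hJ⟩
    rw [Plant.closedLoop_of_D₂₂_eq_zero h.D₂₂_eq_zero'] at hcl
    -- The change of controller touches only the input, output and direct matrices, so the state
    -- matrix `a` is kept.
    refine (h.internallyStabilizedBy_iff hA).2 ⟨k, a, b * Wᴴ, V * c, V * d * Wᴴ + -J, ?_,
      hurwitz_of_hurwitz_fromBlocks hcl hK⟩
    rw [← const_mul_transfer_mul_const_add, sub_eq_add_neg]
    congr 1
    ext i j
    simp [const]
  · rintro ⟨hH, hst, hL, hJ⟩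
    have hK : InHInf K := by
      rw [← h.inv_mul_mul_inv K]
      exact ((inHInf_const _).mul hH |>.mul (inHInf_const _)).add (inHInf_const _)
    obtain ⟨k, a, b, c, d, e, ha⟩ := (h.internallyStabilizedBy_iff hA).1 hst
    have hKt := (h.inv_mul_mul_inv K).symm
    rw [e, const_mul_transfer_mul_const_add] at hKt
    obtain ⟨r, -, hr, hb⟩ := (h.hInfNorm_lft_lt_iff hA hK).1 hL
    refine ⟨hK, ⟨_, _, _, _, _, hKt, ?_, ?_⟩,
      (h.hInfNorm_lft_shifted_lt_iff hA hK (h.isUnit_det_one_sub hKt)).2 hL, hJ⟩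
    · simp [h.D₂₂_eq_zero']
    · refine h.hurwitz_closedLoop_shifted hA ha (hKt ▸ hK) fun s hs => ?_
      rw [← hKt]
      exact (hb s hs).trans_lt hr

end

end PlantShift

/-! ### Verification of the loop shift for the concrete state-space data. -/

section InvSqrt
open scoped MatrixOrder

variable {k : ℕ} {R : Matrix (Fin k) (Fin k) ℂ}

theorem invSqrt_mul_self (hR : R.PosDef) : invSqrt R * invSqrt R = R⁻¹ :=
  CFC.sqrt_mul_sqrt_self _ (Matrix.nonneg_iff_posSemidef.2 hR.inv.posSemidef)

theorem posSemidef_invSqrt (R : Matrix (Fin k) (Fin k) ℂ) : (invSqrt R).PosSemidef :=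
  Matrix.nonneg_iff_posSemidef.1 (CFC.sqrt_nonneg _)

/-- The positive definite inverse square root fixes every vector which `R` fixes. -/
theorem invSqrt_mul_of_mul_eq {l : ℕ} (hR : R.PosDef) {E : Matrix (Fin k) (Fin l) ℂ}
    (hE : R * E = E) : invSqrt R * E = E := by
  have hRu := (Matrix.isUnit_iff_isUnit_det _).1 hR.isUnit
  have h1 : invSqrt R * (invSqrt R * E) = E := by
    rw [← Matrix.mul_assoc, invSqrt_mul_self hR]
    nth_rewrite 1 [← hE]
    rw [← Matrix.mul_assoc, Matrix.nonsing_inv_mul _ hRu, Matrix.one_mul]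
  have h2 : (1 + invSqrt R).PosDef := Matrix.PosDef.one.add_posSemidef (posSemidef_invSqrt R)
  -- With X = R^{-1/2}, X²E = E factors as (1 + X)(X - 1)E = 0, and 1 + X is positive definite.
  have h3 : (1 + invSqrt R) * (invSqrt R * E - E) = 0 := by
    rw [Matrix.add_mul, Matrix.one_mul, Matrix.mul_sub, h1]
    abel
  have h4 : invSqrt R * E - E = 0 := by
    rw [← Matrix.one_mul (invSqrt R * E - E),
      ← Matrix.nonsing_inv_mul _ ((Matrix.isUnit_iff_isUnit_det _).1 h2.isUnit), Matrix.mul_assoc,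
      h3, Matrix.mul_zero]
  exact sub_eq_zero.1 h4

end InvSqrt

section RealDiag

variable {k : ℕ} {σ : Fin k → ℝ}

theorem isUnit_realDiag (h : ∀ i, 0 < σ i) : IsUnit (realDiag σ) := by
  rw [Matrix.isUnit_iff_isUnit_det, realDiag, det_diagonal, isUnit_iff_ne_zero]
  exact Finset.prod_ne_zero_iff.2 fun i _ => Complex.ofReal_ne_zero.2 (h i).ne'

theorem conjTranspose_realDiag : (realDiag σ)ᴴ = realDiag σ := by
  rw [realDiag, diagonal_conjTranspose]
  congr 1
  ext i
  simp

end RealDiag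

namespace FactorData

variable {m p ny n : ℕ} {Y : FactorData m p ny n}

theorem conjTranspose_E₁ : Y.E₁ᴴ = Y.E₁ := by
  rw [E₁, conjTranspose_mul, conjTranspose_conjTranspose]

theorem conjTranspose_projPerp : Y.projPerpᴴ = Y.projPerp := by
  simp only [projPerp, conjTranspose_sub, conjTranspose_one, conjTranspose_mul,
    conjTranspose_conjTranspose, conjTranspose_nonsing_inv, conjTranspose_E₁, Matrix.mul_assoc]

theorem projPerp_mul_conjTranspose (hi : Y.E₁.PosDef) : Y.projPerp * Y.D₁ᴴ = 0 := by
  have : Y.E₁⁻¹ * (Y.D₁ * Y.D₁ᴴ) = 1 :=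
    Matrix.nonsing_inv_mul _ ((Matrix.isUnit_iff_isUnit_det _).1 hi.isUnit)
  rw [projPerp, Matrix.sub_mul, Matrix.one_mul, Matrix.mul_assoc, Matrix.mul_assoc, this,
    Matrix.mul_one, sub_self]

theorem projPerp_mul_self (hi : Y.E₁.PosDef) : Y.projPerp * Y.projPerp = Y.projPerp := by
  nth_rewrite 2 [projPerp]
  rw [Matrix.mul_sub, Matrix.mul_one, ← Matrix.mul_assoc, ← Matrix.mul_assoc,
    projPerp_mul_conjTranspose hi, Matrix.zero_mul, Matrix.zero_mul, sub_zero]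

variable {g : ℝ} {W12 : Matrix (Fin p) (Fin p) ℂ}

theorem conjTranspose_S : (Y.S g W12)ᴴ = ((1 / g : ℝ) : ℂ) • (Y.D₂ * Y.projPerp * W12) := by
  simp only [S, conjTranspose_smul, conjTranspose_mul, conjTranspose_conjTranspose,
    conjTranspose_projPerp, Matrix.mul_assoc]
  congr 1
  exact Complex.conj_ofReal _

/-- As Π is a Hermitian idempotent and W̄₁₂ is unitary, R₁ = g⁻²(g² I - D₂ Π D₂†), which is
assumption (ii) rescaled. -/
theorem posDef_R₁ (hg : 0 < g) (hi : Y.E₁.PosDef) (hW12 : W12 ∈ Matrix.unitaryGroup (Fin p) ℂ)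
    (hii : (((g ^ 2 : ℝ) : ℂ) • (1 : Matrix (Fin n) (Fin n) ℂ)
      - Y.D₂ * Y.projPerp * Y.D₂ᴴ).PosDef) : (Y.R₁ g W12).PosDef := by
  have hW : W12 * W12ᴴ = 1 := Matrix.mem_unitaryGroup_iff.1 hW12
  have hg' : (g : ℂ) ≠ 0 := Complex.ofReal_ne_zero.2 hg.ne'
  have e : Y.R₁ g W12 = ((1 / g ^ 2 : ℝ) : ℂ) • (((g ^ 2 : ℝ) : ℂ) • (1 : Matrix (Fin n) (Fin n) ℂ)
      - Y.D₂ * Y.projPerp * Y.D₂ᴴ) := by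
    have h1 : Y.D₂ * Y.projPerp * W12 * (W12ᴴ * Y.projPerp * Y.D₂ᴴ) =
        Y.D₂ * Y.projPerp * Y.D₂ᴴ := by
      calc _ = Y.D₂ * (Y.projPerp * (W12 * W12ᴴ) * Y.projPerp) * Y.D₂ᴴ := by
            simp only [Matrix.mul_assoc]
        _ = _ := by rw [hW, Matrix.mul_one, projPerp_mul_self hi]
    rw [R₁, conjTranspose_S, S, Matrix.smul_mul, Matrix.mul_smul, h1, smul_smul, smul_sub,
      smul_smul]
    push_cast
    congr 1
    · rw [one_div_mul_cancel (pow_ne_zero 2 hg'), one_smul]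
    · congr 1
      field_simp
  rw [e]
  refine hii.smul ?_
  rw [Complex.zero_lt_real]
  positivity

/-- Woodbury's identity (1 - SS†)⁻¹ = 1 + S R₁⁻¹ S† exhibits the inverse as positive definite. -/
theorem posDef_R₂ (h : (Y.R₁ g W12).PosDef) : (Y.R₂ g W12).PosDef := by
  set T := Y.S g W12
  have hu : (1 - Tᴴ * T) * (Y.R₁ g W12)⁻¹ = 1 :=
    Matrix.mul_nonsing_inv _ ((Matrix.isUnit_iff_isUnit_det _).1 h.isUnit)
  have h1 : (1 + T * (Y.R₁ g W12)⁻¹ * Tᴴ).PosDef :=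
    Matrix.PosDef.one.add_posSemidef (h.inv.posSemidef.mul_mul_conjTranspose_same T)
  have h2 : Y.R₂ g W12 * (1 + T * (Y.R₁ g W12)⁻¹ * Tᴴ) = 1 := by
    calc (1 - T * Tᴴ) * (1 + T * (Y.R₁ g W12)⁻¹ * Tᴴ) =
          1 - T * Tᴴ + T * ((1 - Tᴴ * T) * (Y.R₁ g W12)⁻¹) * Tᴴ := by
          simp only [Matrix.mul_add, Matrix.sub_mul, Matrix.mul_sub, Matrix.mul_one, Matrix.one_mul,
            Matrix.mul_assoc]
      _ = 1 := by rw [hu, Matrix.mul_one, sub_add_cancel]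
  rw [← Matrix.inv_eq_left_inv h2]
  exact h1.inv

/-- The defect factors are U = Σ̄₂₁ W̄₂₁† and Q = R₂^{-1/2}. Only U†U = R₁⁻¹ matters for the energy
identity, so U may differ from R₁^{-1/2} by a unitary factor. -/
theorem plantShift (hg : 0 < g) (hi : Y.E₁.PosDef)
    (hii : (((g ^ 2 : ℝ) : ℂ) • (1 : Matrix (Fin n) (Fin n) ℂ)
      - Y.D₂ * Y.projPerp * Y.D₂ᴴ).PosDef)
    {V12 : Matrix (Fin ny) (Fin ny) ℂ} {σ12 : Fin ny → ℝ}
    (hV12 : V12 ∈ Matrix.unitaryGroup (Fin ny) ℂ) (hW12 : W12 ∈ Matrix.unitaryGroup (Fin p) ℂ)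
    (hσ12 : ∀ i, 0 < σ12 i)
    (hD₁ : Y.D₁ = V12 * (realDiag σ12 * (zeroId p ny)ᴴ) * W12ᴴ)
    {W21 : Matrix (Fin n) (Fin n) ℂ} {σ21 : Fin n → ℝ}
    (hW21 : W21 ∈ Matrix.unitaryGroup (Fin n) ℂ) (hσ21 : ∀ i, 0 < σ21 i)
    (hR₁ : invSqrt (Y.R₁ g W12) = W21 * realDiag σ21 * W21ᴴ) :
    PlantShift Y.plant (Y.shiftedPlant g V12 σ12 W12 W21 σ21) g W12 (Y.S g W12)
      (realDiag σ21 * W21ᴴ) (invSqrt (Y.R₂ g W12)) (V g V12 σ12) (W W21 σ21) Y.J := by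
  have hg' : (g : ℂ) ≠ 0 := Complex.ofReal_ne_zero.2 hg.ne'
  have hgg : (g : ℂ) * ((1 / g : ℝ) : ℂ) = 1 := by
    push_cast
    exact mul_one_div_cancel hg'
  have hWr : W12 * W12ᴴ = 1 := Matrix.mem_unitaryGroup_iff.1 hW12
  have hVl : V12ᴴ * V12 = 1 := Matrix.mem_unitaryGroup_iff'.1 hV12
  have hXl : W21ᴴ * W21 = 1 := Matrix.mem_unitaryGroup_iff'.1 hW21
  have hXr : W21 * W21ᴴ = 1 := Matrix.mem_unitaryGroup_iff.1 hW21
  have hs := isUnit_realDiag hσ12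
  have hT := isUnit_realDiag hσ21
  have hsr : realDiag σ12 * (realDiag σ12)⁻¹ = 1 :=
    Matrix.mul_nonsing_inv _ ((Matrix.isUnit_iff_isUnit_det _).1 hs)
  have hTl : (realDiag σ21)⁻¹ * realDiag σ21 = 1 :=
    Matrix.nonsing_inv_mul _ ((Matrix.isUnit_iff_isUnit_det _).1 hT)
  have hTr : realDiag σ21 * (realDiag σ21)⁻¹ = 1 :=
    Matrix.mul_nonsing_inv _ ((Matrix.isUnit_iff_isUnit_det _).1 hT)
  have hsi : IsUnit (realDiag σ12)⁻¹ := Matrix.isUnit_nonsing_inv_iff.2 hs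
  have hTi : IsUnit (realDiag σ21)⁻¹ := Matrix.isUnit_nonsing_inv_iff.2 hT
  have hP1 := posDef_R₁ hg hi hW12 hii
  have hP2 := posDef_R₂ hP1
  have hD₁' : Y.D₁ᴴ = W12 * zeroId p ny * realDiag σ12 * V12ᴴ := by
    rw [hD₁]
    simp only [conjTranspose_mul, conjTranspose_conjTranspose, conjTranspose_realDiag,
      Matrix.mul_assoc]
  have hD₁V : Y.D₁ᴴ * (V12 * (realDiag σ12)⁻¹) = W12 * zeroId p ny := by
    calc _ = W12 * zeroId p ny * (realDiag σ12 * (V12ᴴ * V12) * (realDiag σ12)⁻¹) := by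
          rw [hD₁']
          simp only [Matrix.mul_assoc]
      _ = _ := by rw [hVl, Matrix.mul_one, hsr, Matrix.mul_one]
  -- The matrix W̄₁₂ col(0, I) equals D₁† V̄₁₂ Σ̄₁₂⁻¹, and Π annihilates the range of D₁†.
  have hSE : (Y.S g W12)ᴴ * zeroId p ny = 0 := by
    rw [conjTranspose_S, Matrix.smul_mul, Matrix.mul_assoc, ← hD₁V, Matrix.mul_assoc,
      ← Matrix.mul_assoc Y.projPerp, projPerp_mul_conjTranspose hi, Matrix.zero_mul,
      Matrix.mul_zero, smul_zero]
  have hUU : (realDiag σ21 * W21ᴴ)ᴴ * (realDiag σ21 * W21ᴴ) = (Y.R₁ g W12)⁻¹ := by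
    calc _ = W21 * realDiag σ21 * (W21ᴴ * W21) * realDiag σ21 * W21ᴴ := by
          simp only [hXl, Matrix.mul_one, conjTranspose_mul, conjTranspose_conjTranspose,
            conjTranspose_realDiag, Matrix.mul_assoc]
      _ = invSqrt (Y.R₁ g W12) * invSqrt (Y.R₁ g W12) := by
          rw [hR₁]
          simp only [Matrix.mul_assoc]
      _ = _ := invSqrt_mul_self hP1
  have hleft : (realDiag σ21 * W21ᴴ)ᴴ * (realDiag σ21 * W21ᴴ) * Y.R₁ g W12 = 1 := by
    rw [hUU, Matrix.nonsing_inv_mul _ ((Matrix.isUnit_iff_isUnit_det _).1 hP1.isUnit)]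
  have hWH : (W W21 σ21)ᴴ = (realDiag σ21)⁻¹ * W21ᴴ := by
    rw [W, conjTranspose_mul, conjTranspose_nonsing_inv, conjTranspose_realDiag]
  have hXR : W21ᴴ * invSqrt (Y.R₁ g W12) = realDiag σ21 * W21ᴴ := by
    rw [hR₁, ← Matrix.mul_assoc, ← Matrix.mul_assoc, hXl, Matrix.one_mul]
  refine
  { C₂_eq_zero := rfl
    D₂₁_eq_one := rfl
    D₂₂_eq_zero := rfl
    D₁₁_eq_zero' := rfl
    D₂₁_eq_one' := rfl
    D₂₂_eq_zero' := rfl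
    g_pos := hg
    Ω_mem := hW12
    loopShift := ⟨hleft, ?_⟩
    isUnit_V := ?_
    isUnit_W := (IsUnit.of_mul_eq_one _ hXr).mul hTi
    U_mul := ?_
    S_mul := hSE
    Q_mul := invSqrt_mul_of_mul_eq hP2 ?_
    A_eq := ?_
    B₁_eq := ?_
    B₂_eq := ?_
    C₁_eq := ?_
    C₂_eq := ?_
    D₁₁_eq := ?_
    D₁₂_eq := ?_ }
  · rw [(posSemidef_invSqrt _).isHermitian.eq, invSqrt_mul_self hP2]
    exact Matrix.nonsing_inv_mul _ ((Matrix.isUnit_iff_isUnit_det _).1 hP2.isUnit)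
  · rw [V]
    exact (IsUnit.smul (Units.mk0 _ hg') ((IsUnit.of_mul_eq_one_right _ hVl).mul hsi))
  · rw [hWH]
    -- Both sides of the goal are inverses of W̄₂₁ Σ̄₂₁, one from the right and one from the left,
    -- hence equal.
    have h1 : W21 * realDiag σ21 * (realDiag σ21 * W21ᴴ * Y.R₁ g W12) = 1 := by
      rw [← hleft]
      simp only [conjTranspose_mul, conjTranspose_conjTranspose, conjTranspose_realDiag,
        Matrix.mul_assoc]
    have h2 : (realDiag σ21)⁻¹ * W21ᴴ * (W21 * realDiag σ21) = 1 := by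
      rw [Matrix.mul_assoc, ← Matrix.mul_assoc W21ᴴ, hXl, Matrix.one_mul, hTl]
    change realDiag σ21 * W21ᴴ * Y.R₁ g W12 = _
    exact (left_inv_eq_right_inv h2 h1).symm
  · change (1 - Y.S g W12 * (Y.S g W12)ᴴ) * zeroId p ny = zeroId p ny
    rw [Matrix.sub_mul, Matrix.one_mul, Matrix.mul_assoc, hSE, Matrix.mul_zero, sub_zero]
  -- R₁⁻¹ splits as (W̄₂₁ Σ̄₂₁)(W̄₂₁† R₁^{-1/2}); the two factors are those in B̃₁ and C̃₂.
  · have h1 : W21 * realDiag σ21 * (W21ᴴ * invSqrt (Y.R₁ g W12)) = (Y.R₁ g W12)⁻¹ := by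
      rw [← Matrix.mul_assoc, ← hR₁, invSqrt_mul_self hP1]
    simp only [shiftedPlant, plant]
    rw [← h1, Matrix.smul_mul, Matrix.mul_smul, smul_smul]
    congr 2
    · push_cast
      field_simp
    · simp only [Matrix.mul_assoc]
  · rw [hWH]
    simp only [shiftedPlant, plant, J]
    rw [Matrix.smul_mul, smul_smul, hgg, one_smul, Matrix.mul_assoc _ (realDiag σ21),
      ← Matrix.mul_assoc (realDiag σ21), hTr, Matrix.one_mul, Matrix.mul_assoc _ W21, hXr,
      Matrix.mul_one]
    simp only [Matrix.mul_assoc]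
  · simp only [shiftedPlant, plant, V, Matrix.mul_smul, Matrix.mul_assoc]
  · simp only [shiftedPlant, plant, Matrix.mul_assoc]
  · simp only [shiftedPlant, plant]
    rw [hXR, conjTranspose_S, Matrix.smul_mul, Matrix.mul_smul, Matrix.mul_assoc _ W12,
      ← Matrix.mul_assoc W12, hWr, Matrix.one_mul]
    simp only [Matrix.mul_assoc]
  · simp only [plant, J, S]
    rw [Matrix.mul_smul, smul_smul, hgg, one_smul, Matrix.mul_assoc W12ᴴ, ← Matrix.mul_assoc W12, hWr,
      Matrix.one_mul, projPerp, Matrix.sub_mul, Matrix.one_mul]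
    simp only [Matrix.mul_assoc]
  · simp only [shiftedPlant, plant, V]
    rw [Matrix.mul_smul, hD₁V]

theorem hBar_eq (V12 : Matrix (Fin ny) (Fin ny) ℂ) (σ12 : Fin ny → ℝ)
    (W21 : Matrix (Fin n) (Fin n) ℂ) (σ21 : Fin n → ℝ) (K : TFMat ny n) :
    Y.hBar g V12 σ12 W21 σ21 K =
      const (V g V12 σ12) * K * const (W W21 σ21)ᴴ - const Y.J := by
  rw [hBar, V, W, J, conjTranspose_mul, conjTranspose_nonsing_inv, conjTranspose_realDiag]

end FactorData

end TwoDisk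

end

/-! ### The equivalence and the bijection of solutions. -/

open TwoDisk
theorem lemma2 {m p ny n : ℕ} (Y : FactorData m p ny n) (γ lam g : ℝ)
    (hγ : 0 < γ) (hlam : 0 ≤ lam) (hg : g = gammaBar γ lam)
    (hA : Hurwitz Y.A)
    -- Assumption (i)
    (hi : Y.E₁.PosDef)
    -- Assumption (ii)
    (hii : (((γ ^ 2 + lam ^ 2 : ℝ) : ℂ) • (1 : Matrix (Fin n) (Fin n) ℂ)
      - Y.D₂ * Y.projPerp * Y.D₂ᴴ).PosDef)
    -- an arbitrary singular value decomposition `D₁ = V̄₁₂ [0 Σ̄₁₂] W̄₁₂†`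
    (V12 : Matrix (Fin ny) (Fin ny) ℂ) (σ12 : Fin ny → ℝ) (W12 : Matrix (Fin p) (Fin p) ℂ)
    (hV12 : V12 ∈ Matrix.unitaryGroup (Fin ny) ℂ) (hW12 : W12 ∈ Matrix.unitaryGroup (Fin p) ℂ)
    (hσ12 : ∀ i, 0 < σ12 i)
    (hD₁ : Y.D₁ = V12 * (realDiag σ12 * (zeroId p ny)ᴴ) * W12ᴴ)
    -- an arbitrary singular value decomposition `R₁^{-1/2} = W̄₂₁ Σ̄₂₁ W̄₂₁†`
    (W21 : Matrix (Fin n) (Fin n) ℂ) (σ21 : Fin n → ℝ)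
    (hW21 : W21 ∈ Matrix.unitaryGroup (Fin n) ℂ) (hσ21 : ∀ i, 0 < σ21 i)
    (hR₁ : invSqrt (Y.R₁ g W12) = W21 * realDiag σ21 * W21ᴴ) :
    -- `V` and `W` are nonsingular
    (IsUnit (FactorData.V g V12 σ12) ∧ IsUnit (FactorData.W W21 σ21)) ∧
    -- one problem is solvable iff the other one is
    ((∃ H : TFMat ny n, Y.plant.SolvesContractiveTwoDisk g H) ↔
      ∃ K : TFMat ny n, (Y.shiftedPlant g V12 σ12 W12 W21 σ21).SolvesTwoDisk 1
        (FactorData.V g V12 σ12) (FactorData.W W21 σ21) Y.J K) ∧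
    -- the solutions correspond to each other
    Set.BijOn (Y.hBar g V12 σ12 W21 σ21)
      {K | (Y.shiftedPlant g V12 σ12 W12 W21 σ21).SolvesTwoDisk 1
        (FactorData.V g V12 σ12) (FactorData.W W21 σ21) Y.J K}
      {H | Y.plant.SolvesContractiveTwoDisk g H} := by
  have hgp : 0 < g := by
    rw [hg, gammaBar]
    exact Real.sqrt_pos.2 (by positivity)
  have hg2 : γ ^ 2 + lam ^ 2 = g ^ 2 := by
    rw [hg, gammaBar, Real.sq_sqrt (by positivity)]
  rw [hg2] at hii
  have h := FactorData.plantShift hgp hi hii hV12 hW12 hσ12 hD₁ hW21 hσ21 hR₁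
  have hiff := h.solvesTwoDisk_iff hA.conjTranspose
  have hbij : Set.BijOn (Y.hBar g V12 σ12 W21 σ21)
      {K | (Y.shiftedPlant g V12 σ12 W12 W21 σ21).SolvesTwoDisk 1
        (FactorData.V g V12 σ12) (FactorData.W W21 σ21) Y.J K}
      {H | Y.plant.SolvesContractiveTwoDisk g H} := by
    refine ⟨fun K hK => ?_, fun K _ K' _ e => ?_, fun H hH => ?_⟩
    · rw [FactorData.hBar_eq]
      exact (hiff K).1 hK
    · rw [FactorData.hBar_eq, FactorData.hBar_eq] at e
      rw [← h.inv_mul_mul_inv K, e, h.inv_mul_mul_inv]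
    -- The preimage is K = V⁻¹ (H + J) (W†)⁻¹.
    · refine ⟨_, (hiff _).2 ?_, (FactorData.hBar_eq ..).trans (h.mul_inv_mul_inv_mul H)⟩
      rw [h.mul_inv_mul_inv_mul]
      exact hH
  refine ⟨⟨h.isUnit_V, h.isUnit_W⟩, ⟨fun ⟨H, hH⟩ => ?_, fun ⟨K, hK⟩ => ⟨_, hbij.mapsTo hK⟩⟩, hbij⟩
  obtain ⟨K, hK, -⟩ := hbij.surjOn hH
  exact ⟨K, hK⟩
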